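/- All matroids are on finite ground sets. A positroid is a matroid $M$ for which there is a linear order $e_1<e_2<\cdots<e_n$ on its ground set $E(M)$ and a real $r\times n$ matrix, where $r$ is the rank of $M$, whose columns, in order, represent $e_1,\dots,e_n$ (a set of elements is independent in $M$ if and only if the corresponding columns are linearly independent), and all of whose $r\times r$ submatrices (columns kept in order) have nonnegative determinant. Let $M$ and $N$ be matroids with $E(M)\cap E(N)=\{p\}$. An amalgam of $M$ and $N$ is a matroid $K$ on $E(M)\cup E(N)$ with $K|E(M)=M$ and $K|E(N)=N$; it is the free amalgam if every set that is independent in some amalgam of $M$ and $N$ is independent in $K$. If $p$ has the same rank in $M$ and in $N$, the parallel connection $P(M,N)$ is the free amalgam of $M$ and $N$ (which exists and is unique). If $p$ is a loop of $M$ but not of $N$, then $P(M,N)=M\oplus(N/p)$; if $p$ is a loop of $N$ but not of $M$, then $P(M,N)=(M/p)\oplus N$. The series connection is $S(M,N)=\bigl(P(M^*,N^*)\bigr)^*$. Corollary. If $M$ and $N$ are positroids with $|E(M)\cap E(N)|=1$, then the parallel connection $P(M,N)$ and the series connection $S(M,N)$ are positroids. -/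

import Mathlib

open Set

namespace Matroid

variable {α : Type*} {M N K K' : Matroid α} {p : α} {I J : Set α}

/-- Let `e₁ < e₂ < ⋯ < eₙ` be a linear order on `E(M)`, given by the enumeration
`e : Fin n ≃ M.E`. It is a positroid order for `M` if `M` is represented by a real `r × n` matrix,
where `r` is the rank of `M` and the `i`-th column represents `eᵢ`, all of whose `r × r` minors are
nonnegative. -/
def IsPositroidOrder (M : Matroid α) {n : ℕ} (e : Fin n ≃ M.E) : Prop :=
  ∃ (r : ℕ) (A : Matrix (Fin r) (Fin n) ℝ),
    M.eRank = r ∧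
    (∀ S : Set (Fin n), M.Indep ((fun i => (e i : α)) '' S) ↔ LinearIndepOn ℝ A.col S) ∧
    ∀ c : Fin r → Fin n, StrictMono c → 0 ≤ (A.submatrix id c).det

/-- A positroid is a matroid (on a finite set) that has a positroid order. -/
def IsPositroid (M : Matroid α) : Prop :=
  ∃ (n : ℕ) (e : Fin n ≃ M.E), M.IsPositroidOrder e

/-- `K` is an amalgam of `M` and `N`: a matroid on `E(M) ∪ E(N)` with `K|E(M) = M` and
`K|E(N) = N`. -/
structure IsAmalgam (K M N : Matroid α) : Prop where
  ground_eq : K.E = M.E ∪ N.E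
  restrict_left : K ↾ M.E = M
  restrict_right : K ↾ N.E = N

/-- `K` is the free amalgam of `M` and `N`: an amalgam in which every set that is independent in
some amalgam of `M` and `N` is independent. -/
structure IsFreeAmalgam (K M N : Matroid α) : Prop extends IsAmalgam K M N where
  indep_of_indep : ∀ L : Matroid α, IsAmalgam L M N → ∀ I, L.Indep I → K.Indep I

theorem IsFreeAmalgam.unique (h : IsFreeAmalgam K M N) (h' : IsFreeAmalgam K' M N) : K = K' :=
  ext_indep (h.ground_eq.trans h'.ground_eq.symm) fun I _ =>
    ⟨h'.indep_of_indep K h.toIsAmalgam I, h.indep_of_indep K' h'.toIsAmalgam I⟩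

theorem IsAmalgam.indep_left (h : IsAmalgam K M N) (hI : K.Indep I) : M.Indep (I ∩ M.E) := by
  rw [← h.restrict_left]
  exact ⟨hI.subset inter_subset_left, inter_subset_right⟩

theorem IsAmalgam.symm (h : IsAmalgam K M N) : IsAmalgam K N M :=
  ⟨h.ground_eq.trans (union_comm _ _), h.restrict_right, h.restrict_left⟩

/-- The independent sets of the free amalgam when `E(M) ∩ E(N) = {p}` and `p` is a nonloop of both
`M` and `N`. -/
def ParallelIndep (M N : Matroid α) (p : α) (I : Set α) : Prop :=
  I ⊆ M.E ∪ N.E ∧ M.Indep (I ∩ M.E) ∧ N.Indep (I ∩ N.E) ∧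
    (M.Indep (insert p (I ∩ M.E)) ∨ N.Indep (insert p (I ∩ N.E)))

theorem ParallelIndep.symm (h : ParallelIndep M N p I) : ParallelIndep N M p I :=
  ⟨h.1.trans (union_comm _ _).subset, h.2.2.1, h.2.1, h.2.2.2.symm⟩

theorem ParallelIndep.subset (hJ : ParallelIndep M N p J) (h : I ⊆ J) : ParallelIndep M N p I :=
  ⟨h.trans hJ.1, hJ.2.1.subset (inter_subset_inter_left _ h),
    hJ.2.2.1.subset (inter_subset_inter_left _ h),
    hJ.2.2.2.imp (fun h' => h'.subset (insert_subset_insert (inter_subset_inter_left _ h)))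
      (fun h' => h'.subset (insert_subset_insert (inter_subset_inter_left _ h)))⟩

theorem ncard_le_of_no_augment [M.Finite] (hI : M.Indep I) (hJ : M.Indep J)
    (h : ∀ x ∈ J, x ∉ I → ¬ M.Indep (insert x I)) : J.ncard ≤ I.ncard := by
  by_contra! hlt
  have hlt' : I.encard < J.encard := by
    rw [← hI.finite.cast_ncard_eq, ← hJ.finite.cast_ncard_eq]
    exact_mod_cast hlt
  obtain ⟨x, hx, hxI⟩ := hI.augment hJ hlt'
  exact h x hx.1 hx.2 hxI

theorem ncard_add_one_of_inter_eq [M.Finite] [N.Finite] (h : M.E ∩ N.E = {p})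
    (hI : I ⊆ M.E ∪ N.E) :
    I.ncard + 1 = (insert p (I ∩ M.E)).ncard + (I ∩ N.E).ncard := by
  have hp : p ∈ M.E ∩ N.E := h ▸ mem_singleton p
  have hf : (insert p (I ∩ M.E)).Finite := (M.ground_finite.subset inter_subset_right).insert p
  have hfN : (I ∩ N.E).Finite := N.ground_finite.subset inter_subset_right
  have key := ncard_union_add_ncard_inter (insert p (I ∩ M.E)) (I ∩ N.E) hf hfN
  rw [← key]
  have hfI : I.Finite := (M.ground_finite.union N.ground_finite).subset hI
  have hun : insert p (I ∩ M.E) ∪ I ∩ N.E = insert p I := by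
    rw [insert_union, ← inter_union_distrib_left, inter_eq_self_of_subset_left hI]
  have hin : insert p (I ∩ M.E) ∩ (I ∩ N.E) = I ∩ {p} := by
    ext x
    have hx : x ∈ M.E ∩ N.E ↔ x = p := by rw [h, mem_singleton_iff]
    simp only [mem_inter_iff, mem_insert_iff, mem_singleton_iff] at hx ⊢
    grind
  rw [hun, hin]
  by_cases hpI : p ∈ I
  · rw [insert_eq_of_mem hpI, inter_eq_self_of_subset_right (singleton_subset_iff.2 hpI), ncard_singleton]
  · rw [ncard_insert_of_notMem hpI hfI, inter_singleton_eq_empty.2 hpI, ncard_empty]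

theorem ParallelIndep.ncard_le [M.Finite] [N.Finite] (h : M.E ∩ N.E = {p})
    (hI : ParallelIndep M N p I) (hJ : ParallelIndep M N p J)
    (hIp : M.Indep (insert p (I ∩ M.E)))
    (hJp : M.Indep (insert p (J ∩ M.E)) ∨
      N.Indep (insert p (J ∩ N.E)) ∧ ¬ N.Indep (insert p (I ∩ N.E)))
    (hno : ∀ x ∈ J, x ∉ I → ¬ ParallelIndep M N p (insert x I)) : J.ncard ≤ I.ncard := by
  have hp : p ∈ M.E ∩ N.E := h ▸ mem_singleton p
  have hM : ∀ x ∈ insert p (J ∩ M.E), x ∉ insert p (I ∩ M.E) →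
      ¬ M.Indep (insert x (insert p (I ∩ M.E))) := by
    intro x hx hxI hi
    have hxp : x ≠ p := fun hxp => hxI (hxp ▸ mem_insert _ _)
    have hxJ : x ∈ J ∩ M.E := hx.resolve_left hxp
    have hxN : x ∉ N.E := fun hxN => hxp (by simpa [h] using (show x ∈ M.E ∩ N.E from ⟨hxJ.2, hxN⟩))
    have hxnI : x ∉ I := fun h' => hxI (mem_insert_of_mem _ ⟨h', hxJ.2⟩)
    refine hno x hxJ.1 hxnI ⟨insert_subset (Or.inl hxJ.2) hI.1, ?_, ?_, Or.inl ?_⟩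
    · rw [insert_inter_of_mem hxJ.2]
      exact hi.subset (insert_subset_insert (subset_insert _ _))
    · rw [insert_inter_of_notMem hxN]
      exact hI.2.2.1
    · rwa [insert_inter_of_mem hxJ.2, insert_comm]
  have hN : ∀ x ∈ J ∩ N.E, x ∉ I ∩ N.E → ¬ N.Indep (insert x (I ∩ N.E)) := by
    intro x hx hxI hi
    have hxnI : x ∉ I := fun h' => hxI ⟨h', hx.2⟩
    refine hno x hx.1 hxnI ⟨insert_subset (Or.inr hx.2) hI.1, ?_, ?_, Or.inl ?_⟩
    · by_cases hxM : x ∈ M.E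
      · have hxp : x = p := by simpa [h] using (show x ∈ M.E ∩ N.E from ⟨hxM, hx.2⟩)
        rw [insert_inter_of_mem hxM, hxp]
        exact hIp
      · rw [insert_inter_of_notMem hxM]
        exact hI.2.1
    · rwa [insert_inter_of_mem hx.2]
    · by_cases hxM : x ∈ M.E
      · have hxp : x = p := by simpa [h] using (show x ∈ M.E ∩ N.E from ⟨hxM, hx.2⟩)
        rw [insert_inter_of_mem hxM, hxp, insert_idem]
        exact hIp
      · rwa [insert_inter_of_notMem hxM]
  have cI := ncard_add_one_of_inter_eq h hI.1
  rcases hJp with hJp | ⟨hJp, hIn⟩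
  · have cJ := ncard_add_one_of_inter_eq h hJ.1
    have h1 := ncard_le_of_no_augment hIp hJp hM
    have h2 := ncard_le_of_no_augment hI.2.2.1 hJ.2.2.1 hN
    omega
  · have cJ := ncard_add_one_of_inter_eq ((inter_comm _ _).trans h) hJ.symm.1
    have h1 := ncard_le_of_no_augment hIp hJ.2.1 fun x hx => hM x (mem_insert_of_mem _ hx)
    have h2 := ncard_le_of_no_augment hI.2.2.1 hJp fun x hx hxI => by
      rcases hx with rfl | hx
      · exact hIn
      · exact hN x hx hxI
    omega

theorem ParallelIndep.exists_insert [M.Finite] [N.Finite] (h : M.E ∩ N.E = {p})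
    (hI : ParallelIndep M N p I) (hJ : ParallelIndep M N p J) (hlt : I.ncard < J.ncard) :
    ∃ x ∈ J, x ∉ I ∧ ParallelIndep M N p (insert x I) := by
  by_contra! hno
  refine hlt.not_ge ?_
  have h' : N.E ∩ M.E = {p} := (inter_comm _ _).trans h
  have hno' : ∀ x ∈ J, x ∉ I → ¬ ParallelIndep N M p (insert x I) :=
    fun x hx hxI hi => hno x hx hxI hi.symm
  by_cases hM : M.Indep (insert p (I ∩ M.E))
  · by_cases hN : N.Indep (insert p (I ∩ N.E))
    · rcases hJ.2.2.2 with hJM | hJN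
      · exact hI.ncard_le h hJ hM (Or.inl hJM) hno
      · exact hI.symm.ncard_le h' hJ.symm hN (Or.inl hJN) hno'
    · exact hI.ncard_le h hJ hM (hJ.2.2.2.imp_right fun hJN => ⟨hJN, hN⟩) hno
  · exact hI.symm.ncard_le h' hJ.symm (hI.2.2.2.resolve_left hM)
      (hJ.2.2.2.symm.imp_right fun hJM => ⟨hJM, hM⟩) hno'

theorem exists_isFreeAmalgam_of_isNonloop [M.Finite] [N.Finite] (h : M.E ∩ N.E = {p})
    (hM : M.IsNonloop p) (hN : N.IsNonloop p) : ∃ K : Matroid α, IsFreeAmalgam K M N := by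
  have hp : p ∈ M.E ∩ N.E := h ▸ mem_singleton p
  have aux : ∀ {M N : Matroid α}, M.E ∩ N.E = {p} → N.IsNonloop p → ∀ I, M.Indep I →
      ParallelIndep M N p I := by
    intro M N h hN I hI
    have hsub : I ∩ N.E ⊆ {p} := h ▸ inter_subset_inter_left _ hI.subset_ground
    have hpi : N.Indep {p} := indep_singleton.2 hN
    exact ⟨hI.subset_ground.trans subset_union_left, hI.subset inter_subset_left, hpi.subset hsub,
      Or.inr (hpi.subset (insert_subset (mem_singleton p) hsub))⟩
  obtain ⟨K, hKE, hKI⟩ : ∃ K : Matroid α, K.E = M.E ∪ N.E ∧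
      ∀ I, K.Indep I ↔ ParallelIndep M N p I :=
    ⟨(IndepMatroid.ofFinite (M.ground_finite.union N.ground_finite) (ParallelIndep M N p)
      (aux h hN ∅ M.empty_indep) (fun I J hJ hIJ => ParallelIndep.subset hJ hIJ)
      (fun I J hI hJ hlt => ParallelIndep.exists_insert h hI hJ hlt)
      (fun I hI => And.left hI)).matroid, rfl, fun I => Iff.rfl⟩
  refine ⟨K, ⟨hKE, ?_, ?_⟩, ?_⟩
  · refine ext_indep rfl fun I hIE => ?_
    have hIE' : I ⊆ M.E := hIE
    rw [restrict_indep_iff, and_iff_left hIE', hKI]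
    exact ⟨fun hI => inter_eq_self_of_subset_left hIE' ▸ hI.2.1, aux h hN I⟩
  · refine ext_indep rfl fun I hIE => ?_
    have hIE' : I ⊆ N.E := hIE
    rw [restrict_indep_iff, and_iff_left hIE', hKI]
    exact ⟨fun hI => inter_eq_self_of_subset_left hIE' ▸ hI.2.2.1,
      fun hI => (aux ((inter_comm _ _).trans h) hM I hI).symm⟩
  · intro L hL I hI
    rw [hKI]
    have hIM := hL.indep_left hI
    have hIN := hL.symm.indep_left hI
    refine ⟨hL.ground_eq ▸ hI.subset_ground, hIM, hIN, ?_⟩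
    by_contra! hcon
    have hLp : L.IsNonloop p := by
      have : (L ↾ M.E).IsNonloop p := by rwa [hL.restrict_left]
      exact this.of_restrict
    have hpI : p ∉ I := fun hpI => hcon.1 (by
      rwa [insert_eq_of_mem (mem_inter hpI hp.1)])
    have key : ∀ {X : Set α} (Q : Matroid α), L ↾ X = Q → p ∈ X → ¬ Q.Indep (insert p (I ∩ X)) →
        p ∈ L.closure (I ∩ X) := by
      rintro X Q rfl hpX hdep
      rw [(hI.subset inter_subset_left).mem_closure_iff_of_notMem fun hh => hpI hh.1]
      rw [dep_iff]
      refine ⟨fun hi => hdep ⟨hi, insert_subset hpX inter_subset_right⟩, ?_⟩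
      exact insert_subset hLp.mem_ground (inter_subset_left.trans hI.subset_ground)
    have h1 := key M hL.restrict_left hp.1 hcon.1
    have h2 := key N hL.restrict_right hp.2 hcon.2
    have hcl := (hI.subset (union_subset inter_subset_left inter_subset_left) :
      L.Indep (I ∩ M.E ∪ I ∩ N.E)).closure_inter_eq_inter_closure
    have hemp : (I ∩ M.E) ∩ (I ∩ N.E) = ∅ := by
      rw [← inter_inter_distrib_left, h, inter_singleton_eq_empty]
      exact hpI
    rw [hemp] at hcl
    have hloop : p ∈ L.closure ∅ := hcl ▸ ⟨h1, h2⟩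
    exact hLp.not_isLoop hloop

theorem disjoint_delete_of_inter_eq (h : M.E ∩ N.E = {p}) : Disjoint M.E (N ＼ {p}).E := by
  rw [delete_ground, disjoint_left]
  intro x hxM hxN
  exact hxN.2 (h ▸ ⟨hxM, hxN.1⟩)

theorem disjoint_contract_of_inter_eq (h : M.E ∩ N.E = {p}) : Disjoint M.E (N ／ {p}).E :=
  disjoint_delete_of_inter_eq h

theorem exists_isFreeAmalgam_of_isLoop (h : M.E ∩ N.E = {p}) (hM : M.IsLoop p)
    (hN : N.IsLoop p) : ∃ K : Matroid α, IsFreeAmalgam K M N := by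
  have hp : p ∈ M.E ∩ N.E := h ▸ mem_singleton p
  have hNi : ∀ I : Set α, N.Indep (I ∩ N.E) → (N ＼ {p}).Indep (I ∩ (N.E \ {p})) := by
    intro I hI
    rw [delete_indep_iff]
    exact ⟨hI.subset (inter_subset_inter_right _ sdiff_subset),
      disjoint_singleton_right.2 fun hh => hh.2.2 rfl⟩
  refine ⟨M.disjointSum (N ＼ {p}) (disjoint_delete_of_inter_eq h), ⟨?_, ?_, ?_⟩, ?_⟩
  · ext x
    simp only [disjointSum_ground_eq, delete_ground, mem_union, mem_sdiff, mem_singleton_iff]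
    constructor
    · tauto
    · rintro (hx | hx)
      · exact Or.inl hx
      · by_cases hxp : x = p
        · exact Or.inl (hxp ▸ hp.1)
        · exact Or.inr ⟨hx, hxp⟩
  · refine ext_indep rfl fun I hIE => ?_
    have hIE' : I ⊆ M.E := hIE
    have hem : I ∩ (N.E \ {p}) = ∅ :=
      ((disjoint_delete_of_inter_eq h).mono_left hIE').inter_eq
    rw [restrict_indep_iff, and_iff_left hIE', disjointSum_indep_iff, delete_ground, hem,
      inter_eq_self_of_subset_left hIE']
    exact ⟨fun hI => hI.1, fun hI => ⟨hI, empty_indep _, hIE'.trans subset_union_left⟩⟩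
  · refine ext_indep rfl fun I hIE => ?_
    have hIE' : I ⊆ N.E := hIE
    rw [restrict_indep_iff, and_iff_left hIE', disjointSum_indep_iff, delete_ground]
    constructor
    · rintro ⟨hIM, hIN, hI⟩
      have hpI : p ∉ I := fun hpI => hM.notMem_of_indep hIM ⟨hpI, hp.1⟩
      have : I ∩ (N.E \ {p}) = I :=
        inter_eq_self_of_subset_left (subset_sdiff_singleton hIE' hpI)
      rw [this, delete_indep_iff] at hIN
      exact hIN.1
    · intro hI
      have hpI : p ∉ I := hN.notMem_of_indep hI
      have hem : I ∩ M.E = ∅ := by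
        refine eq_empty_of_forall_notMem fun x hx => hpI ?_
        have hxp : x ∈ M.E ∩ N.E := ⟨hx.2, hIE' hx.1⟩
        rw [h, mem_singleton_iff] at hxp
        exact hxp ▸ hx.1
      rw [hem]
      refine ⟨empty_indep _, hNi I (hI.subset inter_subset_left), ?_⟩
      exact (subset_sdiff_singleton hIE' hpI).trans subset_union_right
  · intro L hL I hI
    have hIM := hL.indep_left hI
    have hIN := hL.symm.indep_left hI
    rw [disjointSum_indep_iff]
    refine ⟨hIM, hNi I hIN, fun x hx => ?_⟩
    have hxE : x ∈ M.E ∪ N.E := hL.ground_eq ▸ hI.subset_ground hx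
    by_cases hxp : x = p
    · exact Or.inl (hxp ▸ hp.1)
    · exact hxE.imp id fun hxN => ⟨hxN, hxp⟩

theorem exists_isFreeAmalgam [M.Finite] [N.Finite] (h : M.E ∩ N.E = {p})
    (hp : M.IsLoop p ↔ N.IsLoop p) : ∃ K : Matroid α, IsFreeAmalgam K M N := by
  have hpE : p ∈ M.E ∩ N.E := h ▸ mem_singleton p
  by_cases hM : M.IsLoop p
  · exact exists_isFreeAmalgam_of_isLoop h hM (hp.1 hM)
  · exact exists_isFreeAmalgam_of_isNonloop h ((not_isLoop_iff hpE.1).1 hM)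
      ((not_isLoop_iff hpE.2).1 fun hN => hM (hp.2 hN))

open Classical in
/-- The parallel connection `P(M, N)` of `M` and `N` at the base point `p`, where
`E(M) ∩ E(N) = {p}`: the (unique) free amalgam of `M` and `N` if `p` has the same rank in `M` and
in `N`, the direct sum `M ⊕ (N / p)` if `p` is a loop of `M` only, and `(M / p) ⊕ N` if `p` is a
loop of `N` only. -/
noncomputable def parallelConnection (M N : Matroid α) [M.Finite] [N.Finite] (p : α)
    (h : M.E ∩ N.E = {p}) : Matroid α :=
  if hp : M.IsLoop p ↔ N.IsLoop p then
    (exists_isFreeAmalgam h hp).choose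
  else if M.IsLoop p then
    M.disjointSum (N ／ {p}) (disjoint_contract_of_inter_eq h)
  else
    (M ／ {p}).disjointSum N (disjoint_contract_of_inter_eq ((inter_comm _ _).trans h)).symm

/-- The series connection `S(M, N) = (P(M*, N*))*`. -/
noncomputable def seriesConnection (M N : Matroid α) [M.Finite] [N.Finite] (p : α)
    (h : M.E ∩ N.E = {p}) : Matroid α :=
  (parallelConnection M✶ N✶ p (by rwa [dual_ground, dual_ground]))✶

end Matroid

/-!
It suffices to find a representing matrix and an order of the ground set for which all maximal
minors with sorted entries have the same weak sign (`IsPositiveRep`): scaling a row makes a common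
sign positive.

Two closure properties of positroids carry the proof.

* Duality (`IsPositroid.dual`). Extend a representing matrix to an invertible one. By Jacobi's
  identity for complementary minors (`det_complementary_minor`) the remaining part of the inverse
  represents the dual, and its minor on a set equals the complementary minor of the given matrix up
  to a constant and the sign of a shuffle (`exists_sign_shuffle_eq`), which is absorbed by giving
  the elements alternating signs.
* Disjoint unions of bases (`isPositroid_of_isBase_iff`). Cyclic shifts preserve positroid orders, so
  the common element `p` may be taken last in `M` and first in `N`. If the bases of `K` are the
  disjoint unions of a base of `M` and a base of `N`, then the matrix with columns `(a x, b x)` (a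
  block diagonal matrix in which only the column of `p` meets both blocks) represents `K`, and each
  sorted maximal minor factors into a minor of `M` and one of `N`.

The second property covers the parallel connection of `M` and `N` if `p` is a loop of both. In all
other cases the bases of `P(M, N)✶` are exactly the disjoint unions of a base of `M✶` and a base of
`N✶`, so that `P(M, N)` is the dual of a positroid. The series connection follows by duality.
-/

namespace Matroid

/-! ### Representations with minors of one sign -/

/-- `M.IsPositiveRep ρ a` says that the vectors `a x ∈ ℝʳ` represent `M`, and that, with respect to
the order of `E(M)` given by the positions `ρ x`, all `r × r` minors have the same weak sign.
Vectors are rows of the matrices, the bases of `M` are the ranges of the tuples with nonzero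
determinant (so that `r` is the rank of `M`), and elements outside `E(M)` get the zero vector.
Allowing a common sign `ε` makes the notion invariant under row operations. -/
structure IsPositiveRep {α : Type*} (M : Matroid α) (ρ : α → ℤ) {r : ℕ} (a : α → Fin r → ℝ) :
    Prop where
  injOn : InjOn ρ M.E
  eq_zero : ∀ x ∉ M.E, a x = 0
  isBase_iff : ∀ B, M.IsBase B ↔ ∃ c : Fin r → α, range c = B ∧ (Matrix.of (a ∘ c)).det ≠ 0
  exists_sign : ∃ ε : ℝ, ε ≠ 0 ∧ ∀ c : Fin r → α, (∀ i, c i ∈ M.E) → StrictMono (ρ ∘ c) →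
    0 ≤ ε * (Matrix.of (a ∘ c)).det

section Tuples

variable {α : Type*} {ρ : α → ℤ} {r : ℕ}

theorem injective_of_det_ne_zero {a : α → Fin r → ℝ} {c : Fin r → α}
    (h : (Matrix.of (a ∘ c)).det ≠ 0) : Function.Injective c := by
  intro i j hij
  by_contra hne
  exact h (Matrix.det_zero_of_row_eq hne (by ext; simp [hij]))

theorem ne_zero_of_det_ne_zero {a : α → Fin r → ℝ} {c : Fin r → α}
    (h : (Matrix.of (a ∘ c)).det ≠ 0) (i : Fin r) : a (c i) ≠ 0 := by
  intro h0
  exact h (Matrix.det_eq_zero_of_row_eq_zero i (by simp [h0]))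

theorem det_comp_perm (a : α → Fin r → ℝ) (c : Fin r → α) (σ : Equiv.Perm (Fin r)) :
    (Matrix.of (a ∘ c ∘ σ)).det = (Equiv.Perm.sign σ : ℤ) * (Matrix.of (a ∘ c)).det :=
  Matrix.det_permute σ (Matrix.of (a ∘ c))

theorem det_comp_perm_ne_zero {a : α → Fin r → ℝ} {c : Fin r → α} (σ : Equiv.Perm (Fin r))
    (h : (Matrix.of (a ∘ c)).det ≠ 0) : (Matrix.of (a ∘ c ∘ σ)).det ≠ 0 := by
  rw [det_comp_perm]
  exact mul_ne_zero (by exact_mod_cast (Equiv.Perm.sign σ).ne_zero) h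

/-- Distinct elements of `E` can be sorted by their positions. -/
theorem exists_perm_strictMono {E : Set α} (hρ : InjOn ρ E) {c : Fin r → α}
    (hc : Function.Injective c) (hE : ∀ i, c i ∈ E) :
    ∃ σ : Equiv.Perm (Fin r), StrictMono (ρ ∘ c ∘ σ) := by
  refine ⟨Tuple.sort (ρ ∘ c), (Tuple.monotone_sort (ρ ∘ c)).strictMono_of_injective ?_⟩
  intro i j hij
  exact (Tuple.sort (ρ ∘ c)).injective (hc (hρ (hE _) (hE _) hij))

theorem exists_range_eq {S : Set α} (hS : S.Finite) (hr : S.ncard = r) :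
    ∃ c : Fin r → α, Function.Injective c ∧ range c = S := by
  have := hS.to_subtype
  have e : S ≃ Fin r := (Finite.equivFinOfCardEq (by rwa [Nat.card_coe_set_eq]))
  refine ⟨fun i => e.symm i, Subtype.val_injective.comp e.symm.injective, ?_⟩
  ext x
  constructor
  · rintro ⟨i, rfl⟩
    exact (e.symm i).2
  · exact fun hx => ⟨e ⟨x, hx⟩, by simp⟩

theorem linearIndepOn_range_iff_det_ne_zero {a : α → Fin r → ℝ} {c : Fin r → α}
    (hc : Function.Injective c) :
    LinearIndepOn ℝ a (range c) ↔ (Matrix.of (a ∘ c)).det ≠ 0 := by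
  rw [linearIndepOn_range_iff hc, ← isUnit_iff_ne_zero, ← Matrix.isUnit_iff_isUnit_det,
    ← Matrix.linearIndependent_rows_iff_isUnit]
  rfl

end Tuples

section Basic

variable {α : Type*} {M : Matroid α} {ρ : α → ℤ} {r : ℕ} {a : α → Fin r → ℝ}

theorem IsPositiveRep.mem_ground (h : M.IsPositiveRep ρ a) {x : α} (hx : a x ≠ 0) : x ∈ M.E := by
  by_contra hxE
  exact hx (h.eq_zero x hxE)

theorem IsPositiveRep.isBase_range (h : M.IsPositiveRep ρ a) {c : Fin r → α}
    (hc : (Matrix.of (a ∘ c)).det ≠ 0) : M.IsBase (range c) :=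
  (h.isBase_iff _).2 ⟨c, rfl, hc⟩

theorem IsPositiveRep.exists_strictMono (h : M.IsPositiveRep ρ a) {B : Set α} (hB : M.IsBase B) :
    ∃ c : Fin r → α, range c = B ∧ (Matrix.of (a ∘ c)).det ≠ 0 ∧ StrictMono (ρ ∘ c) := by
  obtain ⟨c, rfl, hdet⟩ := (h.isBase_iff B).1 hB
  obtain ⟨σ, hσ⟩ := exists_perm_strictMono h.injOn (injective_of_det_ne_zero hdet)
    fun i => h.mem_ground (ne_zero_of_det_ne_zero hdet i)
  exact ⟨c ∘ σ, σ.surjective.range_comp c, det_comp_perm_ne_zero σ hdet, hσ⟩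

theorem IsPositiveRep.ncard_isBase (h : M.IsPositiveRep ρ a) {B : Set α} (hB : M.IsBase B) :
    B.ncard = r := by
  obtain ⟨c, rfl, hdet⟩ := (h.isBase_iff B).1 hB
  rw [← image_univ, ncard_image_of_injective _ (injective_of_det_ne_zero hdet), ncard_univ,
    Nat.card_fin]

theorem IsPositiveRep.indep_iff (h : M.IsPositiveRep ρ a) (I : Set α) :
    M.Indep I ↔ LinearIndepOn ℝ a I := by
  constructor
  · intro hI
    obtain ⟨B, hB, hIB⟩ := hI.exists_isBase_superset
    obtain ⟨c, rfl, hdet⟩ := (h.isBase_iff B).1 hB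
    exact ((linearIndepOn_range_iff_det_ne_zero (injective_of_det_ne_zero hdet)).2 hdet).mono hIB
  · intro hI
    have hIE : I ⊆ M.E := fun x hx => h.mem_ground (hI.ne_zero hx)
    obtain ⟨J, hJE, hIJ, hsp, hJ⟩ := exists_linearIndepOn_extension hI hIE
    obtain ⟨B, hB⟩ := M.exists_isBase
    obtain ⟨c, rfl, hdet⟩ := (h.isBase_iff B).1 hB
    have htop : Submodule.span ℝ (a '' J) = ⊤ := by
      have hli : LinearIndependent ℝ (a ∘ c) := (linearIndepOn_range_iff
        (injective_of_det_ne_zero hdet) a).1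
          ((linearIndepOn_range_iff_det_ne_zero (injective_of_det_ne_zero hdet)).2 hdet)
      have := hli.span_eq_top_of_card_eq_finrank' (by simp)
      rw [eq_top_iff, ← this, Submodule.span_le]
      rintro _ ⟨i, rfl⟩
      exact hsp ⟨c i, hB.subset_ground ⟨i, rfl⟩, rfl⟩
    have hJfin : J.Finite := hJ.finite
    have hcard : J.ncard = r := by
      have := hJfin.fintype
      have h1 := linearIndependent_iff_card_eq_finrank_span.1 hJ
      have h2 : range (fun x : J => a x) = a '' J := by
        rw [image_eq_range]
      rw [Set.finrank, h2, htop, finrank_top, Module.finrank_fin_fun] at h1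
      rw [← h1, ncard_eq_toFinset_card', toFinset_card]
    obtain ⟨c', hc', rfl⟩ := exists_range_eq hJfin hcard
    exact (h.isBase_range ((linearIndepOn_range_iff_det_ne_zero hc').1 hJ)).indep.subset hIJ

end Basic

section Positroid

variable {α : Type*} {M : Matroid α}

theorem IsPositroid.exists_isPositiveRep (h : M.IsPositroid) :
    ∃ (ρ : α → ℤ) (r : ℕ) (a : α → Fin r → ℝ), M.IsPositiveRep ρ a := by
  classical
  obtain ⟨n, e, r, A, hr, hind, hpos⟩ := h
  set a : α → Fin r → ℝ := fun x => if hx : x ∈ M.E then A.col (e.symm ⟨x, hx⟩) else 0 with ha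
  set ρ : α → ℤ := fun x => if hx : x ∈ M.E then ((e.symm ⟨x, hx⟩ : ℕ) : ℤ) else 0 with hρ
  have hae : ∀ i, a (e i) = A.col i := fun i => by simp [ha]
  have hρe : ∀ i, ρ (e i) = (i : ℕ) := fun i => by simp [hρ]
  have hinj : Function.Injective fun i => (e i : α) := Subtype.val_injective.comp e.injective
  have hlift : ∀ c : Fin r → α, (∀ i, c i ∈ M.E) → ∃ d : Fin r → Fin n, c = fun i => (e (d i) : α) :=
    fun c hc => ⟨fun i => e.symm ⟨c i, hc i⟩, by simp⟩
  have hdet : ∀ d : Fin r → Fin n,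
      (Matrix.of (a ∘ fun i => (e (d i) : α))).det = (A.submatrix id d).det := by
    intro d
    rw [← Matrix.det_transpose]
    congr 1
    ext i j
    simp [hae]
  have hindd : ∀ d : Fin r → Fin n, Function.Injective d →
      (M.Indep (range fun i => (e (d i) : α)) ↔ (A.submatrix id d).det ≠ 0) := by
    intro d hd
    have h1 : (range fun i => (e (d i) : α)) = (fun i => (e i : α)) '' range d := by
      rw [← range_comp]; rfl
    rw [h1, hind, linearIndepOn_range_iff hd, ← isUnit_iff_ne_zero,
      ← Matrix.isUnit_iff_isUnit_det, ← Matrix.linearIndependent_cols_iff_isUnit]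
    rfl
  refine ⟨ρ, r, a, ?_, fun x hx => by simp [ha, hx], ?_, 1, one_ne_zero, ?_⟩
  · intro x hx y hy hxy
    have := e.symm.injective (a₁ := ⟨x, hx⟩) (a₂ := ⟨y, hy⟩)
    simp only [hρ, hx, hy, dif_pos] at hxy
    simpa using this (Fin.ext (by exact_mod_cast hxy))
  · intro B
    constructor
    · intro hB
      have hBr : B.encard = r := hB.encard_eq_eRank.trans hr
      have hBf : B.Finite := finite_of_encard_eq_coe hBr
      obtain ⟨c, hc, rfl⟩ := exists_range_eq hBf (r := r) (by rw [ncard_def, hBr]; rfl)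
      obtain ⟨d, rfl⟩ := hlift c fun i => hB.subset_ground ⟨i, rfl⟩
      refine ⟨_, rfl, ?_⟩
      rw [hdet]
      exact (hindd d fun i j hij => hc (by simp [hij])).1 hB.indep
    · rintro ⟨c, rfl, hdc⟩
      have hcE : ∀ i, c i ∈ M.E := by
        intro i
        by_contra hi
        exact ne_zero_of_det_ne_zero hdc i (by simp [ha, hi])
      have hci := injective_of_det_ne_zero hdc
      obtain ⟨d, rfl⟩ := hlift c hcE
      rw [hdet] at hdc
      have hI := (hindd d fun i j hij => hci (by simp [hij])).2 hdc
      obtain ⟨B, hB, hIB⟩ := hI.exists_isBase_superset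
      have hBr : B.encard = r := hB.encard_eq_eRank.trans hr
      have : (range fun i => (e (d i) : α)).encard = r := by
        rw [← image_univ, hci.encard_image, encard_univ, ENat.card_eq_coe_fintype_card,
          Fintype.card_fin]
      have hIB' := (finite_of_encard_eq_coe this).eq_of_subset_of_encard_le hIB (by rw [hBr, this])
      rwa [hIB']
  · intro c hcE hmono
    obtain ⟨d, rfl⟩ := hlift c hcE
    rw [hdet, one_mul]
    refine hpos d fun i j hij => ?_
    have := hmono hij
    simp only [Function.comp_apply, hρe] at this
    exact_mod_cast this

theorem exists_sorted_equiv {ρ : α → ℤ} {E : Set α} (hE : E.Finite) (hρ : InjOn ρ E) {n : ℕ}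
    (hn : E.ncard = n) : ∃ e : Fin n ≃ E, StrictMono fun i => ρ (e i) := by
  obtain ⟨c, hc, hcE⟩ := exists_range_eq hE hn
  obtain ⟨σ, hσ⟩ := exists_perm_strictMono hρ hc fun i => hcE ▸ mem_range_self i
  refine ⟨σ.trans ((Equiv.ofInjective c hc).trans (Equiv.setCongr hcE)), hσ⟩

theorem IsPositiveRep.isPositroid [M.Finite] {ρ : α → ℤ} {r : ℕ} {a : α → Fin r → ℝ}
    (h : M.IsPositiveRep ρ a) : M.IsPositroid := by
  obtain ⟨e, he⟩ := exists_sorted_equiv M.ground_finite h.injOn rfl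
  have hinj : Function.Injective fun i => (e i : α) := Subtype.val_injective.comp e.injective
  obtain ⟨ε, hε, hsign⟩ := h.exists_sign
  -- Scaling one row turns the common sign into `+`; in rank `0` the only minor is already `1`.
  obtain ⟨u, hu, hpos⟩ : ∃ u : Fin r → ℝ, (∀ i, u i ≠ 0) ∧ ∀ c : Fin r → α, (∀ i, c i ∈ M.E) →
      StrictMono (ρ ∘ c) → 0 ≤ (∏ i, u i) * (Matrix.of (a ∘ c)).det := by
    rcases r with _ | r
    · exact ⟨fun _ => 1, by simp, by simp⟩
    · refine ⟨fun i => if i = 0 then ε else 1, fun i => by by_cases hi : i = 0 <;> simp [hi, hε],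
        fun c hc hm => ?_⟩
      rw [Finset.prod_ite_eq' Finset.univ 0 fun _ => ε]
      simpa using hsign c hc hm
  refine ⟨_, e, r, Matrix.of fun i j => u i * a (e j) i, ?_, ?_, ?_⟩
  · obtain ⟨B, hB⟩ := M.exists_isBase
    rw [← hB.encard_eq_eRank, ← (M.ground_finite.subset hB.subset_ground).cast_ncard_eq,
      h.ncard_isBase hB]
  · intro S
    rw [h.indep_iff]
    let D : (Fin r → ℝ) ≃ₗ[ℝ] (Fin r → ℝ) :=
      LinearEquiv.piCongrRight fun i => LinearEquiv.smulOfNeZero ℝ ℝ (u i) (hu i)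
    have hcol : (Matrix.of fun i j => u i * a (e j) i).col = D ∘ (a ∘ fun i => (e i : α)) := by
      ext j i
      simp [D, Matrix.col]
    rw [hcol]
    have h1 : LinearIndepOn ℝ (D ∘ (a ∘ fun i => (e i : α))) S ↔
        LinearIndepOn ℝ (a ∘ fun i => (e i : α)) S :=
      LinearMap.linearIndependent_iff (v := fun x : S => (a ∘ fun i => (e i : α)) x) D.toLinearMap
        D.ker
    rw [h1]
    exact (linearIndependent_equiv' (Equiv.Set.image _ S hinj) rfl).symm
  · intro d hd
    have h1 : (Matrix.of fun i j => u i * a (e j) i).submatrix id d =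
        Matrix.of fun i j => u i * (Matrix.of (a ∘ fun i => (e (d i) : α))).transpose i j := by
      ext; simp
    rw [h1, Matrix.det_mul_column, Matrix.det_transpose]
    exact hpos _ (fun i => (e (d i)).2) (he.comp hd)

end Positroid

/-! ### Cyclic shifts of a positroid order -/

section Rotation

variable {α : Type*} {M : Matroid α} {ρ : α → ℤ} {r : ℕ} {a : α → Fin r → ℝ} {p x : α}

theorem det_smul_comp (u : α → ℝ) (a : α → Fin r → ℝ) (c : Fin r → α) :
    (Matrix.of ((fun y => u y • a y) ∘ c)).det = (∏ i, u (c i)) * (Matrix.of (a ∘ c)).det :=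
  Matrix.det_mul_column (fun i => u (c i)) (Matrix.of (a ∘ c))

/-- Moving the last element to the front keeps a representation positive once its vector is
multiplied by `(-1) ^ (r - 1)`, the sign of the cyclic permutation of the rows of an `r × r`
minor. -/
theorem IsPositiveRep.rotate [DecidableEq α] (h : M.IsPositiveRep ρ a) (hx : x ∈ M.E)
    (hmax : ∀ y ∈ M.E, ρ y ≤ ρ x) {m : ℤ} (hm : ∀ y ∈ M.E, m < ρ y) :
    M.IsPositiveRep (Function.update ρ x m)
      (fun y => (if y = x then (-1 : ℝ) ^ (r - 1) else 1) • a y) := by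
  set u : α → ℝ := fun y => if y = x then (-1 : ℝ) ^ (r - 1) else 1 with hu
  have hu0 : ∀ y, u y ≠ 0 := fun y => by by_cases hy : y = x <;> simp [hu, hy]
  have hρx : Function.update ρ x m x = m := Function.update_self ..
  have hρ : ∀ y, y ≠ x → Function.update ρ x m y = ρ y := fun y hy =>
    Function.update_of_ne hy ..
  obtain ⟨ε, hε, hsign⟩ := h.exists_sign
  refine ⟨?_, fun y hy => by simp [h.eq_zero y hy], fun B => ?_, ε, hε, ?_⟩
  · intro y hy z hz hyz
    by_cases hyx : y = x <;> by_cases hzx : z = x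
    · rw [hyx, hzx]
    · rw [hyx, hρx, hρ z hzx] at hyz
      exact absurd hyz (hm z hz).ne
    · rw [hzx, hρx, hρ y hyx] at hyz
      exact absurd hyz (hm y hy).ne'
    · rw [hρ y hyx, hρ z hzx] at hyz
      exact h.injOn hy hz hyz
  · rw [h.isBase_iff]
    refine exists_congr fun c => and_congr_right fun _ => ?_
    rw [det_smul_comp, mul_ne_zero_iff, and_iff_right (Finset.prod_ne_zero_iff.2 fun i _ => hu0 _)]
  · intro c hc hmono
    rw [det_smul_comp u]
    by_cases hxc : ∃ i, c i = x
    · obtain ⟨i, hi⟩ := hxc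
      rcases r with _ | r
      · exact i.elim0
      have hc0 : c 0 = x := by
        by_contra h0
        have hlt := hmono ((Fin.pos_iff_ne_zero (a := i)).2 fun hi0 => h0 (hi0 ▸ hi))
        simp only [Function.comp_apply, hi, hρx, hρ _ h0] at hlt
        exact (hm _ (hc 0)).not_gt hlt
      have hinj : Function.Injective c := fun j k hjk => hmono.injective (by simp [hjk])
      have hcs : ∀ i : Fin r, c i.succ ≠ x := fun i hi =>
        i.succ_ne_zero (hinj (hi.trans hc0.symm))
      have hprod : ∏ i, u (c i) = (-1 : ℝ) ^ r := by
        rw [Fin.prod_univ_succ, Finset.prod_eq_one fun i _ => by simp [hu, hcs i]]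
        simp [hu, hc0]
      have hrot : StrictMono (ρ ∘ c ∘ finRotate (r + 1)) := by
        intro i j hij
        induction i using Fin.lastCases with
        | last => exact absurd hij (Fin.le_last j).not_gt
        | cast i =>
          induction j using Fin.lastCases with
          | last =>
            simp only [Function.comp_apply, finRotate_last, hc0]
            refine (hmax _ (hc _)).lt_of_ne fun heq => hcs i ?_
            simpa [finRotate_apply] using h.injOn (hc _) hx heq
          | cast j =>
            have hlt := hmono (Fin.succ_lt_succ_iff.2 (Fin.castSucc_lt_castSucc_iff.1 hij))
            simp only [Function.comp_apply, hρ _ (hcs _)] at hlt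
            simpa [finRotate_apply] using hlt
      have hs := hsign _ (fun i => hc _) hrot
      rw [show (fun i => c (finRotate (r + 1) i)) = c ∘ finRotate (r + 1) from rfl,
        det_comp_perm, sign_finRotate] at hs
      rw [hprod]
      simpa using hs
    · push Not at hxc
      rw [Finset.prod_eq_one fun i _ => by simp [hu, hxc i], one_mul]
      refine hsign c hc fun i j hij => ?_
      have hlt := hmono hij
      simpa only [Function.comp_apply, hρ _ (hxc _)] using hlt

theorem exists_forall_mem_lt [M.Finite] (ρ : α → ℤ) : ∃ m, ∀ y ∈ M.E, m < ρ y := by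
  obtain ⟨m, hm⟩ := (M.ground_finite.image ρ).bddBelow
  exact ⟨m - 1, fun y hy => (sub_one_lt m).trans_le (hm ⟨y, hy, rfl⟩)⟩

/-- Any element can be made the last one, by moving the later elements to the front one by one. -/
theorem IsPositiveRep.exists_isPositiveRep_max [M.Finite] (h : M.IsPositiveRep ρ a)
    (hp : p ∈ M.E) : ∃ (ρ' : α → ℤ) (a' : α → Fin r → ℝ), M.IsPositiveRep ρ' a' ∧
      ∀ y ∈ M.E, ρ' y ≤ ρ' p := by
  classical
  induction hn : {y ∈ M.E | ρ p < ρ y}.ncard using Nat.strong_induction_on generalizing ρ a with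
  | _ n ih =>
  obtain ⟨x, hx, hmax⟩ := exists_max_image M.E ρ M.ground_finite ⟨p, hp⟩
  by_cases hpx : x = p
  · exact ⟨ρ, a, h, hpx ▸ hmax⟩
  have hlt : ρ p < ρ x := (hmax p hp).lt_of_ne fun heq => hpx (h.injOn hp hx heq).symm
  obtain ⟨m, hm⟩ := M.exists_forall_mem_lt ρ
  refine ih _ ?_ (h.rotate hx hmax hm) rfl
  rw [← hn]
  refine ncard_lt_ncard ⟨fun y hy => ?_, fun hsub => ?_⟩
    (M.ground_finite.subset (sep_subset _ _))
  · obtain ⟨hyE, hy⟩ := hy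
    rw [Function.update_of_ne (Ne.symm hpx)] at hy
    by_cases hyx : y = x
    · exact ⟨hyE, hyx ▸ hlt⟩
    · rw [Function.update_of_ne hyx] at hy
      exact ⟨hyE, hy⟩
  · have := (hsub ⟨hx, hlt⟩).2
    rw [Function.update_of_ne (Ne.symm hpx), Function.update_self] at this
    exact this.not_gt (hm p hp)

theorem IsPositiveRep.sub_const (h : M.IsPositiveRep ρ a) (k : ℤ) :
    M.IsPositiveRep (fun y => ρ y - k) a := by
  obtain ⟨ε, hε, hsign⟩ := h.exists_sign
  refine ⟨fun y hy z hz hyz => h.injOn hy hz (by simpa using hyz), h.eq_zero, h.isBase_iff, ε, hε,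
    fun c hc hm => hsign c hc fun i j hij => by simpa using hm hij⟩

theorem IsPositroid.exists_isPositiveRep_nonpos [M.Finite] (h : M.IsPositroid) (hp : p ∈ M.E) :
    ∃ (ρ : α → ℤ) (r : ℕ) (a : α → Fin r → ℝ), M.IsPositiveRep ρ a ∧ ρ p = 0 ∧
      ∀ y ∈ M.E, ρ y ≤ 0 := by
  obtain ⟨ρ, r, a, h⟩ := h.exists_isPositiveRep
  obtain ⟨ρ', a', h', hmax⟩ := h.exists_isPositiveRep_max hp
  exact ⟨_, r, a', h'.sub_const (ρ' p), sub_self _, fun y hy => sub_nonpos.2 (hmax y hy)⟩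

theorem IsPositroid.exists_isPositiveRep_nonneg [M.Finite] (h : M.IsPositroid) (hp : p ∈ M.E) :
    ∃ (ρ : α → ℤ) (r : ℕ) (a : α → Fin r → ℝ), M.IsPositiveRep ρ a ∧ ρ p = 0 ∧
      ∀ y ∈ M.E, 0 ≤ ρ y := by
  classical
  obtain ⟨ρ, r, a, h⟩ := h.exists_isPositiveRep
  obtain ⟨ρ', a', h', hmax⟩ := h.exists_isPositiveRep_max hp
  obtain ⟨m, hm⟩ := M.exists_forall_mem_lt ρ'
  refine ⟨_, r, _, (h'.rotate hp hmax hm).sub_const m, by simp, fun y hy => ?_⟩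
  by_cases hyp : y = p
  · simp [hyp]
  · simpa [hyp] using (hm y hy).le

end Rotation

/-! ### Block diagonal representations -/

section Union

variable {α : Type*} {M N K : Matroid α} {r s : ℕ} {p : α}

/-- If one off-diagonal block vanishes, the determinant is the product of those of the diagonal
blocks. -/
theorem det_append_comp (a : α → Fin r → ℝ) (b : α → Fin s → ℝ) (c : Fin (r + s) → α)
    (h : (∀ i, b (c (Fin.castAdd s i)) = 0) ∨ ∀ j, a (c (Fin.natAdd r j)) = 0) :
    (Matrix.of ((fun x => Fin.append (a x) (b x)) ∘ c)).det =
      (Matrix.of (a ∘ c ∘ Fin.castAdd s)).det * (Matrix.of (b ∘ c ∘ Fin.natAdd r)).det := by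
  rw [← Matrix.det_submatrix_equiv_self finSumFinEquiv]
  have hblock : (Matrix.of ((fun x => Fin.append (a x) (b x)) ∘ c)).submatrix
      finSumFinEquiv finSumFinEquiv = Matrix.fromBlocks (Matrix.of (a ∘ c ∘ Fin.castAdd s))
        (Matrix.of (b ∘ c ∘ Fin.castAdd s)) (Matrix.of (a ∘ c ∘ Fin.natAdd r))
        (Matrix.of (b ∘ c ∘ Fin.natAdd r)) := by
    ext (i | i) (j | j) <;> simp
  rw [hblock]
  rcases h with h | h
  · have h0 : Matrix.of (b ∘ c ∘ Fin.castAdd s) = 0 := by ext i j; simp [h]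
    rw [h0, Matrix.det_fromBlocks_zero₁₂]
  · have h0 : Matrix.of (a ∘ c ∘ Fin.natAdd r) = 0 := by ext i j; simp [h]
    rw [h0, Matrix.det_fromBlocks_zero₂₁]

/-- If the bases of `K` are the disjoint unions of a base of `M` and a base of `N`, and these are
positroids sharing only `p`, then `K` is a positroid. Rotating the orders so that `p` is last in `M`
and first in `N`, the order `E(M) - p < p < E(N) - p` works for the vectors `(a x, b x)`, where `a`
and `b` represent `M` and `N`: a sorted minor is the product of the minor of `a` on the first `r`
entries and the minor of `b` on the last `s`. -/
theorem isPositroid_of_isBase_iff [M.Finite] [N.Finite] (hMN : M.E ∩ N.E = {p})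
    (hM : M.IsPositroid) (hN : N.IsPositroid) (hKE : K.E = M.E ∪ N.E)
    (hK : ∀ B, K.IsBase B ↔ ∃ B₁ B₂, M.IsBase B₁ ∧ N.IsBase B₂ ∧ Disjoint B₁ B₂ ∧ B₁ ∪ B₂ = B) :
    K.IsPositroid := by
  classical
  have hp : p ∈ M.E ∩ N.E := hMN ▸ mem_singleton p
  have hKfin : K.Finite := ⟨hKE ▸ M.ground_finite.union N.ground_finite⟩
  obtain ⟨ρ₁, r, a, ha, hp₁, hneg⟩ := hM.exists_isPositiveRep_nonpos hp.1
  obtain ⟨ρ₂, s, b, hb, hp₂, hnonneg⟩ := hN.exists_isPositiveRep_nonneg hp.2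
  set ρ : α → ℤ := fun x => if x ∈ M.E then ρ₁ x else ρ₂ x with hρ
  have hρM : ∀ x ∈ M.E, ρ x = ρ₁ x := fun x hx => by simp [hρ, hx]
  have hρN : ∀ x ∈ N.E, ρ x = ρ₂ x := by
    intro x hx
    by_cases hxM : x ∈ M.E
    · have hxp : x = p := by simpa [hMN] using (show x ∈ M.E ∩ N.E from ⟨hxM, hx⟩)
      rw [hρM x hxM, hxp, hp₁, hp₂]
    · simp [hρ, hxM]
  have hinj : InjOn ρ (M.E ∪ N.E) := by
    have hmix : ∀ x ∈ M.E, ∀ y ∈ N.E, ρ x = ρ y → x = y := by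
      intro x hx y hy hxy
      have h1 := hneg x hx
      have h2 := hnonneg y hy
      rw [hρM x hx, hρN y hy] at hxy
      have hxp : x = p := ha.injOn hx hp.1 (by omega)
      have hyp : y = p := hb.injOn hy hp.2 (by omega)
      rw [hxp, hyp]
    rintro x (hx | hx) y (hy | hy) hxy
    · exact ha.injOn hx hy (by rwa [← hρM x hx, ← hρM y hy])
    · exact hmix x hx y hy hxy
    · exact (hmix y hy x hx hxy.symm).symm
    · exact hb.injOn hx hy (by rwa [← hρN x hx, ← hρN y hy])
  -- In a sorted tuple, an element of `N` among the first `r` entries keeps `M` out of the last `s`.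
  have hdet : ∀ c : Fin (r + s) → α, (∀ i, c i ∈ M.E ∪ N.E) → StrictMono (ρ ∘ c) →
      (Matrix.of ((fun x => Fin.append (a x) (b x)) ∘ c)).det =
      (Matrix.of (a ∘ c ∘ Fin.castAdd s)).det * (Matrix.of (b ∘ c ∘ Fin.natAdd r)).det := by
    intro c hc hm
    refine det_append_comp a b c ?_
    by_cases hex : ∃ i, c (Fin.castAdd s i) ∈ N.E
    · obtain ⟨i, hi⟩ := hex
      refine Or.inr fun j => ha.eq_zero _ fun hj => ?_
      have hlt := hm (show Fin.castAdd s i < Fin.natAdd r j by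
        simp only [Fin.lt_def, Fin.val_castAdd, Fin.val_natAdd]; omega)
      simp only [Function.comp_apply, hρM _ hj, hρN _ hi] at hlt
      have := hneg _ hj
      have := hnonneg _ hi
      omega
    · push Not at hex
      exact Or.inl fun i => hb.eq_zero _ (hex i)
  have hcast : StrictMono (Fin.castAdd s : Fin r → Fin (r + s)) := Fin.strictMono_castAdd s
  have hnat : StrictMono (Fin.natAdd r : Fin s → Fin (r + s)) := Fin.strictMono_natAdd r
  obtain ⟨ε₁, hε₁, hs₁⟩ := ha.exists_sign
  obtain ⟨ε₂, hε₂, hs₂⟩ := hb.exists_sign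
  have key : K.IsPositiveRep ρ (fun x => Fin.append (a x) (b x)) := by
    refine ⟨hKE ▸ hinj, ?_, ?_, ε₁ * ε₂, mul_ne_zero hε₁ hε₂, ?_⟩
    · intro x hx
      rw [hKE, mem_union, not_or] at hx
      ext i
      induction i using Fin.addCases <;> simp [ha.eq_zero x hx.1, hb.eq_zero x hx.2]
    · intro B
      rw [hK]
      constructor
      · rintro ⟨B₁, B₂, hB₁, hB₂, hdisj, rfl⟩
        obtain ⟨c₁, rfl, hd₁, hm₁⟩ := ha.exists_strictMono hB₁
        obtain ⟨c₂, rfl, hd₂, hm₂⟩ := hb.exists_strictMono hB₂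
        have hE₁ : ∀ i, c₁ i ∈ M.E := fun i => hB₁.subset_ground ⟨i, rfl⟩
        have hE₂ : ∀ i, c₂ i ∈ N.E := fun i => hB₂.subset_ground ⟨i, rfl⟩
        refine ⟨Fin.append c₁ c₂, ?_, ?_⟩
        · ext x
          simp only [mem_range, mem_union]
          constructor
          · rintro ⟨i, rfl⟩
            induction i using Fin.addCases <;> simp
          · rintro (⟨i, rfl⟩ | ⟨i, rfl⟩)
            · exact ⟨Fin.castAdd s i, by simp⟩
            · exact ⟨Fin.natAdd r i, by simp⟩
        · have h1 : Fin.append c₁ c₂ ∘ Fin.castAdd s = c₁ := by ext; simp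
          have h2 : Fin.append c₁ c₂ ∘ Fin.natAdd r = c₂ := by ext; simp
          rw [hdet, h1, h2]
          · exact mul_ne_zero hd₁ hd₂
          · intro i
            induction i using Fin.addCases <;> simp [hE₁, hE₂]
          · intro i j hij
            induction i using Fin.addCases with
            | left i =>
              induction j using Fin.addCases with
              | left j =>
                simpa [hρM _ (hE₁ _)] using hm₁ (hcast.lt_iff_lt.1 hij)
              | right j =>
                simp only [Function.comp_apply, Fin.append_left, Fin.append_right]
                refine lt_of_le_of_ne ?_ fun heq => ?_
                · rw [hρM _ (hE₁ i), hρN _ (hE₂ j)]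
                  exact (hneg _ (hE₁ i)).trans (hnonneg _ (hE₂ j))
                · exact hdisj.ne_of_mem ⟨i, rfl⟩ ⟨j, rfl⟩
                    (hinj (Or.inl (hE₁ i)) (Or.inr (hE₂ j)) heq)
            | right i =>
              induction j using Fin.addCases with
              | left j =>
                simp only [Fin.lt_def, Fin.val_castAdd, Fin.val_natAdd] at hij
                omega
              | right j =>
                simpa [hρN _ (hE₂ _)] using hm₂ (hnat.lt_iff_lt.1 hij)
      · rintro ⟨c, rfl, hd⟩
        have hE : ∀ i, c i ∈ M.E ∪ N.E := by
          intro i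
          by_contra hi
          rw [mem_union, not_or] at hi
          refine ne_zero_of_det_ne_zero hd i ?_
          ext k
          induction k using Fin.addCases <;>
            simp [ha.eq_zero _ hi.1, hb.eq_zero _ hi.2]
        obtain ⟨σ, hσ⟩ := exists_perm_strictMono hinj (injective_of_det_ne_zero hd) hE
        have hd' := det_comp_perm_ne_zero σ hd
        have hcinj := injective_of_det_ne_zero hd'
        rw [← σ.surjective.range_comp c]
        rw [hdet (c ∘ σ) (fun i => hE _) hσ, mul_ne_zero_iff] at hd'
        refine ⟨_, _, ha.isBase_range hd'.1, hb.isBase_range hd'.2, ?_, ?_⟩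
        · rw [disjoint_left]
          rintro _ ⟨i, rfl⟩ ⟨j, hij⟩
          have := congrArg Fin.val (hcinj hij)
          simp only [Fin.val_castAdd, Fin.val_natAdd] at this
          omega
        · ext x
          simp only [mem_range, mem_union]
          constructor
          · rintro (⟨i, rfl⟩ | ⟨i, rfl⟩) <;> exact ⟨_, rfl⟩
          · rintro ⟨i, rfl⟩
            induction i using Fin.addCases with
            | left i => exact Or.inl ⟨i, rfl⟩
            | right i => exact Or.inr ⟨i, rfl⟩
    · intro c hc hm
      rw [hdet c (fun i => hKE ▸ hc i) hm, mul_mul_mul_comm]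
      refine mul_nonneg ?_ ?_
      · by_cases hall : ∀ i, c (Fin.castAdd s i) ∈ M.E
        · refine hs₁ _ hall fun i j hij => ?_
          simpa [hρM _ (hall _)] using hm (hcast hij)
        · push Not at hall
          obtain ⟨i, hi⟩ := hall
          rw [Matrix.det_eq_zero_of_row_eq_zero i (by simp [ha.eq_zero _ hi]), mul_zero]
      · by_cases hall : ∀ i, c (Fin.natAdd r i) ∈ N.E
        · refine hs₂ _ hall fun i j hij => ?_
          simpa [hρN _ (hall _)] using hm (hnat hij)
        · push Not at hall
          obtain ⟨i, hi⟩ := hall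
          rw [Matrix.det_eq_zero_of_row_eq_zero i (by simp [hb.eq_zero _ hi]), mul_zero]
  exact key.isPositroid

end Union

/-! ### Duality -/

section Dual

variable {α : Type*} {M : Matroid α} {ρ : α → ℤ} {r m : ℕ}

/-- The sign of a shuffle: if `π` is increasing on the first `r` and on the last `m` positions,
then, up to a factor depending on `r` and `m` only, its sign is the product of the signs `(-1) ^ v`
over the values `v` taken on the last `m` positions. -/
theorem exists_sign_shuffle_eq (r m : ℕ) : ∃ κ : ℤˣ, ∀ π : Equiv.Perm (Fin (r + m)),
    StrictMono (π ∘ Fin.castAdd m) → StrictMono (π ∘ Fin.natAdd r) →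
    Equiv.Perm.sign π = κ * ∏ k, (-1) ^ (π (Fin.natAdd r k) : ℕ) := by
  refine ⟨∏ k : Fin m, (-1) ^ (r + k : ℕ), fun π h₁ h₂ => ?_⟩
  rw [Equiv.Perm.sign_eq_prod_prod_Iio, Fin.prod_univ_add, Finset.prod_eq_one, one_mul,
    ← Finset.prod_mul_distrib]
  · refine Finset.prod_congr rfl fun k _ => ?_
    set j := Fin.natAdd r k with hj
    rw [Finset.prod_ite, Finset.prod_const_one, one_mul, Finset.prod_const]
    -- All values below `π j` are taken before `j`, so `π j` counts the noninversions at `j`.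
    have h3 : ((Finset.Iio j).filter fun i => π i < π j).card = (π j : ℕ) := by
      rw [← Fin.card_Iio (π j), ← Finset.card_map π.toEmbedding]
      congr 1
      ext x
      simp only [Finset.mem_map_equiv, Finset.mem_filter, Finset.mem_Iio, Equiv.apply_symm_apply,
        and_iff_right_iff_imp]
      intro hx
      by_contra! hle
      obtain ⟨i, rfl⟩ := π.surjective x
      rw [Equiv.symm_apply_apply] at hle
      induction i using Fin.addCases with
      | left i =>
        simp only [hj, Fin.le_def, Fin.val_castAdd, Fin.val_natAdd] at hle
        omega
      | right i =>
        have : k ≤ i := by simpa [hj] using hle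
        exact (h₂.monotone this).not_gt hx
    have h4 := Finset.card_filter_add_card_filter_not (s := Finset.Iio j) (fun i => π i < π j)
    rw [h3, Fin.card_Iio, hj, Fin.val_natAdd, ← hj] at h4
    rw [← h4, pow_add, mul_right_comm, ← mul_pow]
    simp
  · intro j _
    refine Finset.prod_eq_one fun i hi => if_pos ?_
    rw [Finset.mem_Iio] at hi
    induction i using Fin.addCases with
    | left i => exact h₁ ((Fin.strictMono_castAdd m).lt_iff_lt.1 hi)
    | right i =>
      simp only [Fin.lt_def, Fin.val_castAdd, Fin.val_natAdd] at hi
      omega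

/-- Jacobi's identity for complementary minors of a matrix and its inverse, in block form. -/
theorem det_toBlocks₂₂_mul_det {m n : Type*} [Fintype m] [Fintype n] [DecidableEq m]
    [DecidableEq n] {H H' : Matrix (m ⊕ n) (m ⊕ n) ℝ} (h : H' * H = 1) :
    H'.toBlocks₂₂.det * H.det = H.toBlocks₁₁.det := by
  rw [← Matrix.fromBlocks_toBlocks H, ← Matrix.fromBlocks_toBlocks H',
    Matrix.fromBlocks_multiply, ← Matrix.fromBlocks_one, Matrix.fromBlocks_inj] at h
  obtain ⟨-, -, h₂₁, h₂₂⟩ := h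
  have hmul : Matrix.fromBlocks 1 0 H'.toBlocks₂₁ H'.toBlocks₂₂ * H =
      Matrix.fromBlocks H.toBlocks₁₁ H.toBlocks₁₂ 0 1 := by
    conv_lhs => rw [← Matrix.fromBlocks_toBlocks H]
    rw [Matrix.fromBlocks_multiply, h₂₁, h₂₂]
    simp
  have := congrArg Matrix.det hmul
  simpa [Matrix.det_fromBlocks_zero₁₂, Matrix.det_fromBlocks_zero₂₁] using this

theorem det_complementary_minor {G G' : Matrix (Fin (r + m)) (Fin (r + m)) ℝ} (h : G' * G = 1)
    (π : Equiv.Perm (Fin (r + m))) :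
    (Matrix.of fun k l => G' (Fin.natAdd r l) (π (Fin.natAdd r k))).det *
      ((Equiv.Perm.sign π : ℤ) * G.det) =
      (Matrix.of fun k l => G (π (Fin.castAdd m k)) (Fin.castAdd m l)).det := by
  have hmul : (G'.submatrix finSumFinEquiv (finSumFinEquiv.trans π)) *
      (G.submatrix (finSumFinEquiv.trans π) finSumFinEquiv) = 1 := by
    rw [Matrix.submatrix_mul_equiv, h, Matrix.submatrix_one_equiv]
  have hdet := det_toBlocks₂₂_mul_det hmul
  have hG : (G.submatrix (finSumFinEquiv.trans π) finSumFinEquiv).det =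
      (Equiv.Perm.sign π : ℤ) * G.det := by
    rw [← Matrix.det_permute, ← Matrix.det_submatrix_equiv_self finSumFinEquiv]
    rfl
  rw [hG, ← Matrix.det_transpose] at hdet
  exact hdet

theorem exists_perm_of_disjoint_range {n : ℕ} {E : Set α} (e : Fin n ≃ E) {c : Fin r → α}
    {c' : Fin m → α} (hn : n = r + m) (hc : Function.Injective c) (hc' : Function.Injective c')
    (hcE : range c ⊆ E) (hcE' : range c' ⊆ E) (hd : Disjoint (range c) (range c')) :
    ∃ π : Equiv.Perm (Fin (r + m)), (∀ k, (e (Fin.cast hn.symm (π (Fin.castAdd m k))) : α) = c k) ∧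
      ∀ k, (e (Fin.cast hn.symm (π (Fin.natAdd r k))) : α) = c' k := by
  subst hn
  have hE : ∀ i, Fin.append c c' i ∈ E := by
    intro i
    induction i using Fin.addCases with
    | left i => simpa using hcE ⟨i, rfl⟩
    | right i => simpa using hcE' ⟨i, rfl⟩
  have hinj : Function.Injective (Fin.append c c') := by
    rw [Fin.append_injective_iff]
    exact ⟨hc, hc', fun i j hij => hd.ne_of_mem ⟨i, rfl⟩ ⟨j, rfl⟩ hij⟩
  have hbij : Function.Bijective fun i => e.symm ⟨Fin.append c c' i, hE i⟩ :=
    Finite.injective_iff_bijective.1 fun i j hij =>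
      hinj (congrArg Subtype.val (e.symm.injective hij))
  exact ⟨Equiv.ofBijective _ hbij, fun k => by simp, fun k => by simp⟩

/-- The dual is represented, in the same order, by the last rows of the inverse of an invertible
matrix that extends a representation, with alternating signs on the elements: by Jacobi's identity
complementary minors agree up to the sign of a shuffle, which the alternating signs absorb. -/
theorem IsPositiveRep.exists_dual [M.Finite] {a : α → Fin r → ℝ} (h : M.IsPositiveRep ρ a) :
    ∃ (m : ℕ) (b : α → Fin m → ℝ), M✶.IsPositiveRep ρ b := by
  classical
  have hfin : ∀ X ⊆ M.E, X.Finite := fun X hX => M.ground_finite.subset hX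
  obtain ⟨B₀, hB₀⟩ := M.exists_isBase
  obtain ⟨c₀, hc₀, hd₀⟩ := (h.isBase_iff B₀).1 hB₀
  obtain ⟨m, hm⟩ : ∃ m, (M.E \ B₀).ncard = m := ⟨_, rfl⟩
  have hn : M.E.ncard = r + m := by
    rw [← h.ncard_isBase hB₀, ← hm, add_comm, ncard_sdiff_add_ncard_of_subset hB₀.subset_ground
      M.ground_finite]
  have hcompl : ∀ X ⊆ M.E, (M.E \ X).ncard + X.ncard = r + m := fun X hX => by
    rw [ncard_sdiff_add_ncard_of_subset hX M.ground_finite, hn]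
  obtain ⟨e, he⟩ := exists_sorted_equiv M.ground_finite h.injOn hn
  obtain ⟨c₀', hinj₀', hc₀'⟩ := exists_range_eq (hfin _ sdiff_subset) hm
  obtain ⟨π₀, hπ₀, hπ₀'⟩ := exists_perm_of_disjoint_range e rfl (injective_of_det_ne_zero hd₀)
    hinj₀' (hc₀ ▸ hB₀.subset_ground) (hc₀' ▸ sdiff_subset)
    (by rw [hc₀, hc₀']; exact disjoint_sdiff_right)
  set G : Matrix (Fin (r + m)) (Fin (r + m)) ℝ := Matrix.of fun j =>
    Fin.append (a (e j)) fun k => if j = π₀ (Fin.natAdd r k) then 1 else 0 with hG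
  -- Sorting the base `B₀` first makes `G` block triangular, with an identity block.
  have hGdet : G.det ≠ 0 := by
    have h1 : (G.submatrix π₀ id).submatrix finSumFinEquiv finSumFinEquiv =
        Matrix.fromBlocks (Matrix.of (a ∘ c₀)) 0
          (Matrix.of (a ∘ c₀')) 1 := by
      ext (i | i) (j | j)
      · simpa [hG] using congrArg (fun x => a x j) (hπ₀ i)
      · have hne : Fin.castAdd m i ≠ Fin.natAdd r j := by
          simp only [ne_eq, Fin.ext_iff, Fin.val_castAdd, Fin.val_natAdd]
          omega
        simp [hG, hne]
      · simpa [hG] using congrArg (fun x => a x j) (hπ₀' i)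
      · simp [hG, Matrix.one_apply]
    have h2 := congrArg Matrix.det h1
    rw [Matrix.det_submatrix_equiv_self, Matrix.det_permute, Matrix.det_fromBlocks_zero₁₂,
      Matrix.det_one, mul_one] at h2
    exact fun h0 => hd₀ (by rw [← h2, h0, mul_zero])
  have hGinv : G⁻¹ * G = 1 := Matrix.nonsing_inv_mul _ hGdet.isUnit
  set b : α → Fin m → ℝ := fun x => if hx : x ∈ M.E then
    fun k => (-1) ^ (e.symm ⟨x, hx⟩ : ℕ) * G⁻¹ (Fin.natAdd r k) (e.symm ⟨x, hx⟩) else 0 with hb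
  have hbe : ∀ j k, b (e j) k = (-1) ^ (j : ℕ) * G⁻¹ (Fin.natAdd r k) j := fun j k => by simp [hb]
  have hb0 : ∀ x ∉ M.E, b x = 0 := fun x hx => by simp [hb, hx]
  have hsq : ∀ π : Equiv.Perm (Fin (r + m)), (∏ k, (-1 : ℝ) ^ (π (Fin.natAdd r k) : ℕ)) *
      ∏ k, (-1 : ℝ) ^ (π (Fin.natAdd r k) : ℕ) = 1 := by
    intro π
    rw [← Finset.prod_mul_distrib]
    exact Finset.prod_eq_one fun k _ => by rw [← mul_pow]; simp
  -- Complementary minors of `a` and `b` agree up to a nonzero factor.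
  have key : ∀ (c : Fin r → α) (c' : Fin m → α) (π : Equiv.Perm (Fin (r + m))),
      (∀ k, (e (π (Fin.castAdd m k)) : α) = c k) → (∀ k, (e (π (Fin.natAdd r k)) : α) = c' k) →
      (Matrix.of (b ∘ c')).det * ((∏ k, (-1) ^ (π (Fin.natAdd r k) : ℕ)) *
        ((Equiv.Perm.sign π : ℤ) * G.det)) = (Matrix.of (a ∘ c)).det := by
    intro c c' π hc hc'
    have h1 : Matrix.of (b ∘ c') = Matrix.of fun k l => (-1) ^ (π (Fin.natAdd r k) : ℕ) *
        (Matrix.of fun k l => G⁻¹ (Fin.natAdd r l) (π (Fin.natAdd r k))) k l := by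
      ext k l
      simp [← hc', hbe]
    have h2 : Matrix.of (a ∘ c) =
        Matrix.of fun k l => G (π (Fin.castAdd m k)) (Fin.castAdd m l) := by
      ext k l
      simp [← hc, hG]
    rw [h1, Matrix.det_mul_column, h2, ← det_complementary_minor hGinv π]
    linear_combination (Matrix.of fun k l => G⁻¹ (Fin.natAdd r l) (π (Fin.natAdd r k))).det *
      ((Equiv.Perm.sign π : ℤ) * G.det) * hsq π
  have hfactor : ∀ π : Equiv.Perm (Fin (r + m)), (∏ k, (-1 : ℝ) ^ (π (Fin.natAdd r k) : ℕ)) *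
      ((Equiv.Perm.sign π : ℤ) * G.det) ≠ 0 := fun π =>
    mul_ne_zero (Finset.prod_ne_zero_iff.2 fun k _ => pow_ne_zero _ (by norm_num))
      (mul_ne_zero (by exact_mod_cast (Equiv.Perm.sign π).ne_zero) hGdet)
  obtain ⟨ε, hε, hsign⟩ := h.exists_sign
  obtain ⟨κ, hκ⟩ := exists_sign_shuffle_eq r m
  -- Every `m`-tuple of distinct elements has a complementary sorted `r`-tuple.
  have hex : ∀ c' : Fin m → α, Function.Injective c' → (∀ k, c' k ∈ M.E) →
      ∃ c : Fin r → α, Function.Injective c ∧ range c = M.E \ range c' ∧ StrictMono (ρ ∘ c) := by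
    intro c' hc' hcE'
    have hsub : range c' ⊆ M.E := range_subset_iff.2 hcE'
    have h1 := hcompl _ hsub
    rw [← image_univ (f := c'), ncard_image_of_injective _ hc', ncard_univ, Nat.card_fin,
      image_univ] at h1
    obtain ⟨c, hc, hcr⟩ := exists_range_eq (hfin _ sdiff_subset) (Nat.add_right_cancel h1)
    obtain ⟨σ, hσ⟩ := exists_perm_strictMono h.injOn hc fun i => (hcr.subset ⟨i, rfl⟩).1
    exact ⟨c ∘ σ, hc.comp σ.injective, by rw [σ.surjective.range_comp, hcr], hσ⟩
  refine ⟨m, b, h.injOn, hb0, fun B => ?_, ε * ((κ : ℤ) * G.det),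
    mul_ne_zero hε (mul_ne_zero (by exact_mod_cast κ.ne_zero) hGdet), ?_⟩
  · rw [dual_isBase_iff']
    constructor
    · rintro ⟨hB, hBE⟩
      obtain ⟨c, hc, hd⟩ := (h.isBase_iff _).1 hB
      have h1 := hcompl B hBE
      rw [h.ncard_isBase hB] at h1
      obtain ⟨c', hc', rfl⟩ := exists_range_eq (hfin B hBE) (Nat.add_left_cancel h1)
      obtain ⟨π, hπ, hπ'⟩ := exists_perm_of_disjoint_range e rfl (injective_of_det_ne_zero hd) hc'
        (hc ▸ sdiff_subset) hBE (hc ▸ disjoint_sdiff_left)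
      refine ⟨c', rfl, fun h0 => hd ?_⟩
      rw [← key c c' π hπ hπ', h0, zero_mul]
    · rintro ⟨c', rfl, hd⟩
      have hinj' := injective_of_det_ne_zero hd
      have hcE' : ∀ k, c' k ∈ M.E := fun k => by
        by_contra hk
        exact ne_zero_of_det_ne_zero hd k (hb0 _ hk)
      obtain ⟨c, hc, hcr, -⟩ := hex c' hinj' hcE'
      obtain ⟨π, hπ, hπ'⟩ := exists_perm_of_disjoint_range e rfl hc hinj'
        (hcr ▸ sdiff_subset) (range_subset_iff.2 hcE') (hcr ▸ disjoint_sdiff_left)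
      refine ⟨hcr ▸ h.isBase_range ?_, range_subset_iff.2 hcE'⟩
      rw [← key c c' π hπ hπ']
      exact mul_ne_zero hd (hfactor π)
  · intro c' hcE' hm'
    have hinj' : Function.Injective c' := fun j k hjk => hm'.injective (by simp [hjk])
    obtain ⟨c, hc, hcr, hmc⟩ := hex c' hinj' hcE'
    have hsub : range c ⊆ M.E := hcr ▸ sdiff_subset
    obtain ⟨π, hπ, hπ'⟩ := exists_perm_of_disjoint_range e rfl hc hinj' hsub
      (range_subset_iff.2 hcE') (hcr ▸ disjoint_sdiff_left)
    have hmono : StrictMono (π ∘ Fin.castAdd m) := fun i j hij => by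
      rw [← he.lt_iff_lt]
      exact (congrArg ρ (hπ i)).trans_lt ((hmc hij).trans_eq (congrArg ρ (hπ j)).symm)
    have hmono' : StrictMono (π ∘ Fin.natAdd r) := fun i j hij => by
      rw [← he.lt_iff_lt]
      exact (congrArg ρ (hπ' i)).trans_lt ((hm' hij).trans_eq (congrArg ρ (hπ' j)).symm)
    have hs := hsign c (fun i => hsub ⟨i, rfl⟩) hmc
    rw [← key c c' π hπ hπ', hκ π hmono hmono'] at hs
    push_cast at hs
    refine hs.trans_eq ?_
    linear_combination ε * (κ : ℤ) * G.det * (Matrix.of (b ∘ c')).det * hsq π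

theorem IsPositroid.dual [M.Finite] (h : M.IsPositroid) : M✶.IsPositroid := by
  obtain ⟨ρ, r, a, h⟩ := h.exists_isPositiveRep
  obtain ⟨m, b, hb⟩ := h.exists_dual
  exact hb.isPositroid

end Dual

/-! ### Bases of the parallel connection -/

section Connection

variable {α : Type*} {M N K L : Matroid α} {p : α} {B I : Set α}

theorem isAmalgam_of_indep (hE : L.E = M.E ∪ N.E)
    (h : ∀ I, L.Indep I → M.Indep (I ∩ M.E) ∧ N.Indep (I ∩ N.E)) (hM : ∀ I, M.Indep I → L.Indep I)
    (hN : ∀ I, N.Indep I → L.Indep I) : IsAmalgam L M N := by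
  refine ⟨hE, ext_indep rfl fun I hI => ?_, ext_indep rfl fun I hI => ?_⟩
  · have hI' : I ⊆ M.E := hI
    rw [restrict_indep_iff, and_iff_left hI']
    exact ⟨fun hL => inter_eq_self_of_subset_left hI' ▸ (h I hL).1, hM I⟩
  · have hI' : I ⊆ N.E := hI
    rw [restrict_indep_iff, and_iff_left hI']
    exact ⟨fun hL => inter_eq_self_of_subset_left hI' ▸ (h I hL).2, hN I⟩

theorem inter_subset_singleton_of_inter_eq (h : M.E ∩ N.E = {p}) (hI : I ⊆ M.E) :
    I ∩ N.E ⊆ {p} := h ▸ inter_subset_inter_left _ hI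

theorem parallelIndep_of_indep (h : M.E ∩ N.E = {p}) (hN : N.IsNonloop p) (hI : M.Indep I) :
    ParallelIndep M N p I := by
  have hsub := inter_subset_singleton_of_inter_eq h hI.subset_ground
  have hpi : N.Indep {p} := indep_singleton.2 hN
  exact ⟨hI.subset_ground.trans subset_union_left, hI.subset inter_subset_left, hpi.subset hsub,
    Or.inr (hpi.subset (insert_subset (mem_singleton p) hsub))⟩

/-- In an amalgam, the traces of an independent set on `E(M)` and on `E(N)` cannot both span a
common nonloop outside the set, as closures of disjoint parts of an independent set meet in
loops. -/
theorem IsAmalgam.parallelIndep (hL : IsAmalgam L M N) (h : M.E ∩ N.E = {p})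
    (hM : M.IsNonloop p) (hI : L.Indep I) : ParallelIndep M N p I := by
  have hp : p ∈ M.E ∩ N.E := h ▸ mem_singleton p
  refine ⟨hL.ground_eq ▸ hI.subset_ground, hL.indep_left hI, hL.symm.indep_left hI, ?_⟩
  by_contra! hcon
  have hLp : L.IsNonloop p := by
    have : (L ↾ M.E).IsNonloop p := by rwa [hL.restrict_left]
    exact this.of_restrict
  have hpI : p ∉ I := fun hpI => hcon.1 (by
    rw [insert_eq_of_mem (mem_inter hpI hp.1)]
    exact hL.indep_left hI)
  have key : ∀ {X : Set α} (Q : Matroid α), L ↾ X = Q → p ∈ X → ¬ Q.Indep (insert p (I ∩ X)) →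
      p ∈ L.closure (I ∩ X) := by
    rintro X Q rfl hpX hdep
    rw [(hI.subset inter_subset_left).mem_closure_iff_of_notMem fun hh => hpI hh.1, dep_iff]
    exact ⟨fun hi => hdep ⟨hi, insert_subset hpX inter_subset_right⟩,
      insert_subset hLp.mem_ground (inter_subset_left.trans hI.subset_ground)⟩
  have hcl := (hI.subset (union_subset inter_subset_left inter_subset_left) :
    L.Indep (I ∩ M.E ∪ I ∩ N.E)).closure_inter_eq_inter_closure
  have hemp : (I ∩ M.E) ∩ (I ∩ N.E) = ∅ := by
    rw [← inter_inter_distrib_left, h, inter_singleton_eq_empty]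
    exact hpI
  rw [hemp] at hcl
  exact hLp.not_isLoop (hcl ▸ ⟨key M hL.restrict_left hp.1 hcon.1,
    key N hL.restrict_right hp.2 hcon.2⟩ : p ∈ L.closure ∅)

theorem IsFreeAmalgam.indep_iff_parallelIndep [M.Finite] [N.Finite] (hK : IsFreeAmalgam K M N)
    (h : M.E ∩ N.E = {p}) (hM : M.IsNonloop p) (hN : N.IsNonloop p) :
    K.Indep I ↔ ParallelIndep M N p I := by
  refine ⟨hK.toIsAmalgam.parallelIndep h hM, fun hI => ?_⟩
  let L : Matroid α := (IndepMatroid.ofFinite (M.ground_finite.union N.ground_finite)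
    (ParallelIndep M N p) (parallelIndep_of_indep h hN M.empty_indep)
    (fun _ _ hJ hIJ => ParallelIndep.subset hJ hIJ)
    (fun _ _ hI hJ hlt => ParallelIndep.exists_insert h hI hJ hlt) (fun _ hI => hI.1)).matroid
  have hL : IsAmalgam L M N := isAmalgam_of_indep rfl (fun _ hI => ⟨hI.2.1, hI.2.2.1⟩)
    (fun _ hI => parallelIndep_of_indep h hN hI)
    fun _ hI => (parallelIndep_of_indep ((inter_comm _ _).trans h) hM hI).symm
  exact hK.indep_of_indep L hL I hI

/-- Independent sets of the parallel connection have at most `r(M) + r(N) - 1` elements. -/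
theorem ParallelIndep.ncard_lt [M.Finite] [N.Finite] (h : M.E ∩ N.E = {p})
    (hI : ParallelIndep M N p I) {C₁ C₂ : Set α} (h₁ : M.IsBase C₁) (h₂ : N.IsBase C₂) :
    I.ncard < C₁.ncard + C₂.ncard := by
  have aux : ∀ {M : Matroid α} [M.Finite] {C J : Set α}, M.IsBase C → M.Indep J →
      J.ncard ≤ C.ncard := fun hC hJ =>
    ncard_le_of_no_augment hC.indep hJ fun x _ hx hi => hx
      (hC.eq_of_subset_indep hi (subset_insert _ _) ▸ mem_insert _ _)
  rcases hI.2.2.2 with hp | hp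
  · have := ncard_add_one_of_inter_eq h hI.1
    have := aux h₁ hp
    have := aux h₂ hI.2.2.1
    omega
  · have := ncard_add_one_of_inter_eq ((inter_comm _ _).trans h) hI.symm.1
    have := aux h₁ hI.2.1
    have := aux h₂ hp
    omega

/-- The complement of a disjoint union of bases of `M✶` and `N✶`, in terms of the complementary
bases of `M` and `N`. -/
theorem parallelIndep_sdiff_union {C₁ C₂ : Set α} (h₁ : M.IsBase C₁) (h₂ : N.IsBase C₂)
    (hp : p ∈ C₁ ∨ p ∈ C₂) :
    ParallelIndep M N p ((M.E ∪ N.E) \ (M.E \ C₁ ∪ N.E \ C₂)) := by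
  set J := (M.E ∪ N.E) \ (M.E \ C₁ ∪ N.E \ C₂) with hJ
  have hJ₁ : J ∩ M.E ⊆ C₁ := by
    intro x hx
    by_contra hxC
    exact hx.1.2 (Or.inl ⟨hx.2, hxC⟩)
  have hJ₂ : J ∩ N.E ⊆ C₂ := by
    intro x hx
    by_contra hxC
    exact hx.1.2 (Or.inr ⟨hx.2, hxC⟩)
  exact ⟨sdiff_subset, h₁.indep.subset hJ₁, h₂.indep.subset hJ₂,
    hp.imp (fun hp => h₁.indep.subset (insert_subset hp hJ₁))
      fun hp => h₂.indep.subset (insert_subset hp hJ₂)⟩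

/-- When `p` is a nonloop of both matroids, the bases of `K` are the sets of all `x` lying in `C₁`
if `x ∈ E(M)` and in `C₂` if `x ∈ E(N)`, where `C₁` and `C₂` are bases of `M` and `N` at least one
of which contains `p`; their complements are the disjoint unions of bases of the duals. -/
theorem IsFreeAmalgam.dual_isBase_iff [M.Finite] [N.Finite] (hK : IsFreeAmalgam K M N)
    (h : M.E ∩ N.E = {p}) (hM : M.IsNonloop p) (hN : N.IsNonloop p) :
    K✶.IsBase B ↔
      ∃ B₁ B₂, M✶.IsBase B₁ ∧ N✶.IsBase B₂ ∧ Disjoint B₁ B₂ ∧ B₁ ∪ B₂ = B := by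
  have hp : p ∈ M.E ∩ N.E := h ▸ mem_singleton p
  have hind : ∀ {I}, K.Indep I ↔ ParallelIndep M N p I := hK.indep_iff_parallelIndep h hM hN
  rw [dual_isBase_iff', hK.ground_eq]
  constructor
  · rintro ⟨hB, hBE⟩
    have hcompl : ∀ {C₁ C₂ : Set α}, M.IsBase C₁ → N.IsBase C₂ → p ∈ C₁ ∨ p ∈ C₂ →
        ((M.E ∪ N.E) \ B) ∩ M.E ⊆ C₁ → ((M.E ∪ N.E) \ B) ∩ N.E ⊆ C₂ →
        ∃ B₁ B₂, M✶.IsBase B₁ ∧ N✶.IsBase B₂ ∧ Disjoint B₁ B₂ ∧ B₁ ∪ B₂ = B := by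
      intro C₁ C₂ hC₁ hC₂ hpC hsub₁ hsub₂
      refine ⟨_, _, hC₁.compl_isBase_dual, hC₂.compl_isBase_dual, ?_, ?_⟩
      · rw [disjoint_left]
        rintro x ⟨hxM, hx₁⟩ ⟨hxN, hx₂⟩
        have hxp : x = p := by simpa [h] using (show x ∈ M.E ∩ N.E from ⟨hxM, hxN⟩)
        subst hxp
        exact hpC.elim hx₁ hx₂
      · have heq := hB.eq_of_subset_indep (hind.2 (parallelIndep_sdiff_union hC₁ hC₂ hpC)) (by
          rintro x ⟨hxE, hxB⟩
          refine ⟨hxE, ?_⟩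
          rintro (⟨hxM, hx⟩ | ⟨hxN, hx⟩)
          · exact hx (hsub₁ ⟨⟨hxE, hxB⟩, hxM⟩)
          · exact hx (hsub₂ ⟨⟨hxE, hxB⟩, hxN⟩))
        rw [← sdiff_sdiff_cancel_left hBE, heq, sdiff_sdiff_cancel_left
          (union_subset_union sdiff_subset sdiff_subset)]
    obtain ⟨-, hI₁, hI₂, hI | hI⟩ := hind.1 hB.indep
    · obtain ⟨C₁, hC₁, hsub₁⟩ := hI.exists_isBase_superset
      obtain ⟨C₂, hC₂, hsub₂⟩ := hI₂.exists_isBase_superset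
      exact hcompl hC₁ hC₂ (Or.inl (hsub₁ (mem_insert _ _))) ((subset_insert _ _).trans hsub₁) hsub₂
    · obtain ⟨C₁, hC₁, hsub₁⟩ := hI₁.exists_isBase_superset
      obtain ⟨C₂, hC₂, hsub₂⟩ := hI.exists_isBase_superset
      exact hcompl hC₁ hC₂ (Or.inr (hsub₂ (mem_insert _ _))) hsub₁ ((subset_insert _ _).trans hsub₂)
  · rintro ⟨B₁, B₂, hB₁, hB₂, hd, rfl⟩
    have hE₁ : B₁ ⊆ M.E := hB₁.subset_ground
    have hE₂ : B₂ ⊆ N.E := hB₂.subset_ground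
    have hC₁ : M.IsBase (M.E \ B₁) := (dual_isBase_iff hE₁).1 hB₁
    have hC₂ : N.IsBase (N.E \ B₂) := (dual_isBase_iff hE₂).1 hB₂
    refine ⟨?_, union_subset_union hE₁ hE₂⟩
    have hpC : p ∈ M.E \ B₁ ∨ p ∈ N.E \ B₂ := by
      by_contra! hcon
      exact hd.ne_of_mem (not_not.1 fun hp₁ => hcon.1 ⟨hp.1, hp₁⟩)
        (not_not.1 fun hp₂ => hcon.2 ⟨hp.2, hp₂⟩) rfl
    have hJ := parallelIndep_sdiff_union hC₁ hC₂ hpC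
    rw [sdiff_sdiff_cancel_left hE₁, sdiff_sdiff_cancel_left hE₂] at hJ
    obtain ⟨C, hC, hJC⟩ := (hind.2 hJ).exists_isBase_superset
    have hfinE : (M.E ∪ N.E).Finite := M.ground_finite.union N.ground_finite
    have hCE : C ⊆ M.E ∪ N.E := hK.ground_eq ▸ hC.subset_ground
    -- Both sets have `r(M) + r(N) - 1` elements.
    have hlt := (hind.1 hC.indep).ncard_lt h hC₁ hC₂
    have hu := ncard_union_add_ncard_inter M.E N.E M.ground_finite N.ground_finite
    rw [h, ncard_singleton] at hu
    have h1 := ncard_sdiff_add_ncard_of_subset hE₁ M.ground_finite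
    have h2 := ncard_sdiff_add_ncard_of_subset hE₂ N.ground_finite
    have h3 := ncard_sdiff_add_ncard_of_subset (union_subset_union hE₁ hE₂) hfinE
    have h4 := ncard_union_eq hd (M.ground_finite.subset hE₁) (N.ground_finite.subset hE₂)
    rwa [eq_of_subset_of_ncard_le hJC (by omega) (hfinE.subset hCE)]

/-- When `p` is a loop of both matroids, the free amalgam is `M ⊕ (N \ p)`. -/
theorem IsFreeAmalgam.isBase_iff_of_isLoop (hK : IsFreeAmalgam K M N)
    (h : M.E ∩ N.E = {p}) (hM : M.IsLoop p) (hN : N.IsLoop p) :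
    K.IsBase B ↔ ∃ B₁ B₂, M.IsBase B₁ ∧ N.IsBase B₂ ∧ Disjoint B₁ B₂ ∧ B₁ ∪ B₂ = B := by
  have hp : p ∈ M.E ∩ N.E := h ▸ mem_singleton p
  have hE : M.E ∪ (N.E \ {p}) = M.E ∪ N.E := by
    ext x
    have := hp.1
    simp only [mem_union, mem_sdiff, mem_singleton_iff]
    grind
  set L := M.disjointSum (N ＼ {p}) (disjoint_delete_of_inter_eq h) with hLdef
  have hLE : L.E = M.E ∪ N.E := by rw [disjointSum_ground_eq, delete_ground, hE]
  have hLi : ∀ I, L.Indep I ↔ M.Indep (I ∩ M.E) ∧ N.Indep (I ∩ N.E) ∧ I ⊆ M.E ∪ N.E := by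
    intro I
    rw [disjointSum_indep_iff, delete_indep_iff, delete_ground, hE]
    refine and_congr_right fun hIM => and_congr_left fun _ => ?_
    have hpI : p ∉ I := fun hpI => hM.notMem_of_indep hIM ⟨hpI, hp.1⟩
    rw [show I ∩ (N.E \ {p}) = I ∩ N.E by
      rw [← inter_sdiff_assoc, sdiff_singleton_eq_self fun hh => hpI hh.1]]
    exact and_iff_left (disjoint_singleton_right.2 fun hh => hpI hh.1)
  have hempty : ∀ {M N : Matroid α} {I : Set α}, M.E ∩ N.E = {p} → M.IsLoop p → M.Indep I →
      I ∩ N.E = ∅ := by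
    intro M N I h hM hI
    refine eq_empty_of_forall_notMem fun x hx => ?_
    have hxp := inter_subset_singleton_of_inter_eq h hI.subset_ground hx
    exact hM.notMem_of_indep hI (hxp ▸ hx.1)
  have hL : IsAmalgam L M N := by
    refine isAmalgam_of_indep hLE (fun I hI => ⟨((hLi I).1 hI).1, ((hLi I).1 hI).2.1⟩)
      (fun I hI => (hLi I).2 ⟨hI.subset inter_subset_left, ?_, hI.subset_ground.trans
        subset_union_left⟩) fun I hI => (hLi I).2 ⟨?_, hI.subset inter_subset_left,
        hI.subset_ground.trans subset_union_right⟩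
    · rw [hempty h hM hI]
      exact N.empty_indep
    · rw [hempty ((inter_comm _ _).trans h) hN hI]
      exact M.empty_indep
  have hKL : K = L := hK.unique ⟨hL, fun L' hL' I hI => (hLi I).2
    ⟨hL'.indep_left hI, hL'.symm.indep_left hI, hL'.ground_eq ▸ hI.subset_ground⟩⟩
  have hco : N.Coindep {p} := by
    rw [coindep_iff_exists']
    obtain ⟨B, hB⟩ := N.exists_isBase
    exact ⟨⟨B, hB, subset_sdiff_singleton hB.subset_ground (hN.notMem_of_indep hB.indep)⟩,
      singleton_subset_iff.2 hp.2⟩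
  rw [hKL]
  constructor
  · intro hB
    obtain ⟨B₁, B₂, hB₁, hB₂, hd, rfl⟩ := hB.eq_union_image_of_disjointSum
    exact ⟨B₁, B₂, hB₁, (hco.delete_isBase_iff.1 hB₂).1, hd, rfl⟩
  · rintro ⟨B₁, B₂, hB₁, hB₂, -, rfl⟩
    have hp₂ : p ∉ B₂ := hN.notMem_of_indep hB₂.indep
    have hE₁ := hB₁.subset_ground
    have hE₂ := hB₂.subset_ground
    rw [disjointSum_isBase_iff, delete_ground, hE]
    have e₁ : (B₁ ∪ B₂) ∩ M.E = B₁ := by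
      rw [union_inter_distrib_right, inter_eq_self_of_subset_left hE₁,
        hempty ((inter_comm _ _).trans h) hN hB₂.indep, union_empty]
    have e₂ : (B₁ ∪ B₂) ∩ (N.E \ {p}) = B₂ := by
      rw [← inter_sdiff_assoc, union_inter_distrib_right, hempty h hM hB₁.indep, empty_union,
        inter_eq_self_of_subset_left hE₂, sdiff_singleton_eq_self hp₂]
    rw [e₁, e₂]
    exact ⟨hB₁, hco.delete_isBase_iff.2 ⟨hB₂, disjoint_singleton_right.2 hp₂⟩,
      union_subset_union hE₁ hE₂⟩

/-- Here `p` is a coloop of `M✶`, so that disjointness forces the base of `N✶` to avoid `p`. -/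
theorem dual_disjointSum_contract_isBase_iff (h : M.E ∩ N.E = {p}) (hM : M.IsLoop p)
    (hN : N.IsNonloop p) :
    (M.disjointSum (N ／ {p}) (disjoint_contract_of_inter_eq h))✶.IsBase B ↔
      ∃ B₁ B₂, M✶.IsBase B₁ ∧ N✶.IsBase B₂ ∧ Disjoint B₁ B₂ ∧ B₁ ∪ B₂ = B := by
  have hp : p ∈ M.E ∩ N.E := h ▸ mem_singleton p
  have hx : ∀ x, x ∈ M.E → x ∈ N.E → x = p := fun x hxM hxN => by
    simpa [h] using (show x ∈ M.E ∩ N.E from ⟨hxM, hxN⟩)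
  have hcon : ∀ X, (N ／ {p}).IsBase X ↔ N.IsBase (X ∪ {p}) ∧ Disjoint X {p} := fun X =>
    (indep_singleton.2 hN).contract_isBase_iff
  rw [dual_isBase_iff', disjointSum_isBase_iff, disjointSum_ground_eq, contract_ground, hcon]
  have hp₁ := hp.1
  have hp₂ := hp.2
  constructor
  · rintro ⟨⟨h₁, ⟨h₂, -⟩, -⟩, hBE⟩
    refine ⟨B ∩ M.E, B ∩ (N.E \ {p}), ?_, ?_, ?_, ?_⟩
    · rw [dual_isBase_iff inter_subset_right]
      convert h₁ using 1
      ext x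
      simp only [mem_union, mem_sdiff, mem_inter_iff]
      tauto
    · rw [dual_isBase_iff (inter_subset_right.trans sdiff_subset)]
      convert h₂ using 1
      ext x
      simp only [mem_union, mem_sdiff, mem_inter_iff, mem_singleton_iff]
      grind
    · exact (disjoint_contract_of_inter_eq h).mono inter_subset_right inter_subset_right
    · rw [← inter_union_distrib_left, inter_eq_self_of_subset_left hBE]
  · rintro ⟨B₁, B₂, hB₁, hB₂, hd, rfl⟩
    have hE₁ : B₁ ⊆ M.E := hB₁.subset_ground
    have hE₂ : B₂ ⊆ N.E := hB₂.subset_ground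
    have hC₁ : M.IsBase (M.E \ B₁) := (dual_isBase_iff hE₁).1 hB₁
    have hC₂ : N.IsBase (N.E \ B₂) := (dual_isBase_iff hE₂).1 hB₂
    have hpB₁ : p ∈ B₁ := by
      by_contra hpB
      exact hM.notMem_of_indep hC₁.indep ⟨hp.1, hpB⟩
    have hpB₂ : p ∉ B₂ := fun hpB => hd.ne_of_mem hpB₁ hpB rfl
    refine ⟨⟨?_, ⟨?_, ?_⟩, sdiff_subset⟩, ?_⟩
    · convert hC₁ using 1
      ext x
      have := @hE₂ x
      simp only [mem_union, mem_sdiff, mem_inter_iff, mem_singleton_iff]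
      grind
    · convert hC₂ using 1
      ext x
      have := @hE₁ x
      simp only [mem_union, mem_sdiff, mem_inter_iff, mem_singleton_iff]
      grind
    · exact disjoint_singleton_right.2 fun hh => hh.2.2 rfl
    · exact union_subset (hE₁.trans subset_union_left)
        ((subset_sdiff_singleton hE₂ hpB₂).trans subset_union_right)

theorem parallelConnection_ground_eq [M.Finite] [N.Finite] (h : M.E ∩ N.E = {p}) :
    (M.parallelConnection N p h).E = M.E ∪ N.E := by
  have hp : p ∈ M.E ∩ N.E := h ▸ mem_singleton p
  have := hp.1
  have := hp.2
  rw [parallelConnection]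
  split_ifs with h₁ h₂
  · exact (exists_isFreeAmalgam h h₁).choose_spec.ground_eq
  · rw [disjointSum_ground_eq, contract_ground]
    ext x
    simp only [mem_union, mem_sdiff, mem_singleton_iff]
    grind
  · rw [disjointSum_ground_eq, contract_ground]
    ext x
    simp only [mem_union, mem_sdiff, mem_singleton_iff]
    grind

theorem finite_parallelConnection [M.Finite] [N.Finite] (h : M.E ∩ N.E = {p}) :
    (M.parallelConnection N p h).Finite :=
  ⟨parallelConnection_ground_eq h ▸ M.ground_finite.union N.ground_finite⟩

/-- If `p` is a loop of both matroids, the bases of the parallel connection are the disjoint unions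
of bases; in all other cases this holds for the dual of the parallel connection and the dual
matroids. -/
theorem IsPositroid.parallelConnection [M.Finite] [N.Finite] (hM : M.IsPositroid)
    (hN : N.IsPositroid) (h : M.E ∩ N.E = {p}) : (M.parallelConnection N p h).IsPositroid := by
  have hp : p ∈ M.E ∩ N.E := h ▸ mem_singleton p
  have hE := parallelConnection_ground_eq h
  by_cases hloop : M.IsLoop p ∧ N.IsLoop p
  · have hiff : M.IsLoop p ↔ N.IsLoop p := iff_of_true hloop.1 hloop.2
    refine isPositroid_of_isBase_iff h hM hN hE fun B => ?_
    rw [Matroid.parallelConnection, dif_pos hiff]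
    exact (exists_isFreeAmalgam h hiff).choose_spec.isBase_iff_of_isLoop h hloop.1 hloop.2
  · have hfin := finite_parallelConnection h
    suffices hdual : (M.parallelConnection N p h)✶.IsPositroid by
      simpa using hdual.dual
    refine isPositroid_of_isBase_iff (M := M✶) (N := N✶) h hM.dual hN.dual hE fun B => ?_
    rw [Matroid.parallelConnection]
    split_ifs with h₁ h₂
    · have hMp : ¬ M.IsLoop p := fun hMp => hloop ⟨hMp, h₁.1 hMp⟩
      exact (exists_isFreeAmalgam h h₁).choose_spec.dual_isBase_iff h
        ((not_isLoop_iff hp.1).1 hMp) ((not_isLoop_iff hp.2).1 fun hNp => hMp (h₁.2 hNp))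
    · exact dual_disjointSum_contract_isBase_iff h h₂
        ((not_isLoop_iff hp.2).1 fun hNp => hloop ⟨h₂, hNp⟩)
    · have hNp : N.IsLoop p := by tauto
      rw [disjointSum_comm, dual_disjointSum_contract_isBase_iff ((inter_comm _ _).trans h) hNp
        ((not_isLoop_iff hp.1).1 h₂)]
      constructor
      · rintro ⟨B₁, B₂, hB₁, hB₂, hd, rfl⟩
        exact ⟨B₂, B₁, hB₂, hB₁, hd.symm, union_comm _ _⟩
      · rintro ⟨B₁, B₂, hB₁, hB₂, hd, rfl⟩
        exact ⟨B₂, B₁, hB₂, hB₁, hd.symm, union_comm _ _⟩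

end Connection

end Matroid

theorem corollary4p15 {α : Type*} (M N : Matroid α) [M.Finite] [N.Finite] (p : α)
    (hMN : M.E ∩ N.E = {p}) (hM : M.IsPositroid) (hN : N.IsPositroid) :
    (M.parallelConnection N p hMN).IsPositroid ∧ (M.seriesConnection N p hMN).IsPositroid := by
  have hfin := Matroid.finite_parallelConnection (M := M✶) (N := N✶) (p := p) hMN
  exact ⟨hM.parallelConnection hN hMN, (hM.dual.parallelConnection hN.dual (p := p) hMN).dual⟩
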